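/- Let $A$ be a separable $\mathrm{C}^*$-algebra (not necessarily unital) which has an approximate unit $(q_r)_{r\in\mathbb{N}}$ consisting of projections, i.e. $q_r=q_r^*=q_r^2$ and $q_ra\to a$, $aq_r\to a$ in norm for every $a\in A$. Let $\gamma$ be an automorphism of $A$ with finite Rokhlin dimension: there is an integer $d\ge 0$ such that for every finite set $F\subseteq A$, every integer $p\ge 1$ and every $\varepsilon>0$ there are positive contractions $f^{(l)}_0,\dots,f^{(l)}_{p-1}\in A$, $0\le l\le d$, such that, with $f^{(l)}_p:=f^{(l)}_0$, for all $a\in F$, $0\le l\le d$ and $0\le j,k\le p-1$: 1. $\|f^{(l)}_kf^{(l)}_ja\|<\varepsilon$ if $j\ne k$; 2. $\bigl\|\bigl(\sum_{l=0}^d\sum_{k=0}^{p-1}f^{(l)}_k\bigr)a-a\bigr\|<\varepsilon$; 3. $\|f^{(l)}_ja-af^{(l)}_j\|<\varepsilon$; 4. $\|(\gamma(f^{(l)}_j)-f^{(l)}_{j+1})a\|<\varepsilon$. A densely defined lower semicontinuous trace on a $\mathrm{C}^*$-algebra $B$ is a map $\tau:B_+\to[0,\infty]$ that is additive, satisfies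 $\tau(cb)=c\,\tau(b)$ for $c\ge 0$, $b\in B_+$ (with $0\cdot\infty=0$) and $\tau(x^*x)=\tau(xx^*)$ for $x\in B$, is lower semicontinuous in norm, and is such that $\{b\in B_+:\tau(b)<\infty\}$ is dense in $B_+$ (the zero trace is included). Let $A\rtimes_\gamma\mathbb{Z}$ be the crossed product $\mathrm{C}^*$-algebra, with its canonical embedding $A\to A\rtimes_\gamma\mathbb{Z}$. Then the restriction map $\tau\mapsto\tau|_{A_+}$ is a bijection from the set of densely defined lower semicontinuous traces on $A\rtimes_\gamma\mathbb{Z}$ onto the set of densely defined lower semicontinuous traces $\sigma$ on $A$ that are $\gamma$-invariant, i.e. $\sigma(\gamma(a))=\sigma(a)$ for all $a\in A_+$. -/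

import Mathlib

open Filter Topology UniformSpace
open scoped ENNReal NNReal

noncomputable section

/-! ### Traces -/

section Traces

variable {A : Type*} [NonUnitalCStarAlgebra A] [PartialOrder A] [StarOrderedRing A]

/-- A trace on a C⋆-algebra `A`: a map `τ : A₊ → [0, ∞]` on the positive cone which is additive,
positively homogeneous and satisfies `τ (x⋆x) = τ (xx⋆)` for all `x`. (The case `c = 0` of
homogeneity gives `τ 0 = 0`.) -/
structure IsTrace (τ : {a : A // 0 ≤ a} → ℝ≥0∞) : Prop where
  map_add : ∀ (a b : A) (ha : 0 ≤ a) (hb : 0 ≤ b),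
    τ ⟨a + b, add_nonneg ha hb⟩ = τ ⟨a, ha⟩ + τ ⟨b, hb⟩
  map_smul : ∀ (c : ℝ≥0) (a : A) (ha : 0 ≤ a),
    τ ⟨(c : ℝ) • a, smul_nonneg c.coe_nonneg ha⟩ = c * τ ⟨a, ha⟩
  map_star_mul_self : ∀ x : A,
    τ ⟨star x * x, star_mul_self_nonneg x⟩ = τ ⟨x * star x, mul_star_self_nonneg x⟩

/-- A densely defined lower semicontinuous trace: `{a ∈ A₊ | τ a < ∞}` is norm-dense in `A₊`, and
`τ` is lower semicontinuous for the norm topology on `A₊`. -/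
structure IsDenselyDefinedLSCTrace (τ : {a : A // 0 ≤ a} → ℝ≥0∞) : Prop extends IsTrace τ where
  dense_domain : Dense {a : {a : A // 0 ≤ a} | τ a < ∞}
  lowerSemicontinuous : LowerSemicontinuous τ

/-- `τ ∘ γ = τ`. -/
def IsInvariantTrace (γ : A ≃⋆ₐ[ℂ] A) (τ : {a : A // 0 ≤ a} → ℝ≥0∞) : Prop :=
  ∀ a : {a : A // 0 ≤ a}, τ ⟨γ a.1, map_nonneg γ a.2⟩ = τ a

end Traces

/-! ### Rokhlin dimension -/

section Rokhlin

variable {A : Type*} [NonUnitalCStarAlgebra A] [PartialOrder A] [StarOrderedRing A]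

/-- The approximate Rokhlin towers condition with `d + 1` colours. For each colour `l ≤ d` the
tower is `f l 0, …, f l (p - 1)`, and `f l p` denotes `f l 0`. -/
def RokhlinProperty (γ : A ≃⋆ₐ[ℂ] A) (d : ℕ) : Prop :=
  ∀ (F : Finset A) (p : ℕ), 1 ≤ p → ∀ ε : ℝ, 0 < ε →
    ∃ f : ℕ → ℕ → A,
      (∀ l ≤ d, ∀ k < p, 0 ≤ f l k ∧ ‖f l k‖ ≤ 1) ∧
      (∀ l ≤ d, f l p = f l 0) ∧
      (∀ a ∈ F, ∀ l ≤ d, ∀ j < p, ∀ k < p, j ≠ k → ‖f l k * f l j * a‖ < ε) ∧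
      (∀ a ∈ F, ‖(∑ l ∈ Finset.range (d + 1), ∑ k ∈ Finset.range p, f l k) * a - a‖ < ε) ∧
      (∀ a ∈ F, ∀ l ≤ d, ∀ j < p, ‖f l j * a - a * f l j‖ < ε) ∧
      (∀ a ∈ F, ∀ l ≤ d, ∀ j < p, ‖(γ (f l j) - f l (j + 1)) * a‖ < ε)

/-- `γ` has Rokhlin dimension `d`: `d` is the least number with the Rokhlin property. -/
def HasRokhlinDimension (γ : A ≃⋆ₐ[ℂ] A) (d : ℕ) : Prop :=
  IsLeast {d : ℕ | RokhlinProperty γ d} d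

/-- `γ` has finite Rokhlin dimension. -/
def HasFiniteRokhlinDimension (γ : A ≃⋆ₐ[ℂ] A) : Prop :=
  ∃ d : ℕ, HasRokhlinDimension γ d

end Rokhlin

/-! ### The convolution algebra `C_c(ℤ, A)` of an automorphism -/

section Conv

variable {A : Type*} [NonUnitalCStarAlgebra A]

/-- The convolution algebra `C_c(ℤ, A)` of the action of `ℤ` on `A` by powers of `γ`: finitely
supported functions `ℤ → A`, where `f` stands for the formal sum `∑ₙ f(n) uⁿ`. -/
def ConvAlgebra (_γ : A ≃⋆ₐ[ℂ] A) : Type _ := ℤ →₀ A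

namespace ConvAlgebra

variable {γ : A ≃⋆ₐ[ℂ] A}

instance : AddCommGroup (ConvAlgebra γ) := inferInstanceAs (AddCommGroup (ℤ →₀ A))

instance : Module ℂ (ConvAlgebra γ) := inferInstanceAs (Module ℂ (ℤ →₀ A))

variable (γ) in
/-- The element `a uⁿ`. -/
def single (n : ℤ) : A →+ ConvAlgebra γ := Finsupp.singleAddHom n

lemma addHom_ext {B : Type*} [AddMonoid B] {φ ψ : ConvAlgebra γ →+ B}
    (h : ∀ n a, φ (single γ n a) = ψ (single γ n a)) : φ = ψ :=
  Finsupp.addHom_ext h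

lemma smul_single (c : ℂ) (n : ℤ) (a : A) : c • single γ n a = single γ n (c • a) :=
  Finsupp.smul_single c n a

variable (γ) in
/-- The additive map on `C_c(ℤ, A)` with prescribed values on the elements `a uⁿ`. -/
def lift {B : Type*} [AddCommMonoid B] (φ : ℤ → A →+ B) : ConvAlgebra γ →+ B :=
  Finsupp.liftAddHom φ

lemma lift_single {B : Type*} [AddCommMonoid B] (φ : ℤ → A →+ B) (n : ℤ) (a : A) :
    lift γ φ (single γ n a) = φ n a :=
  Finsupp.liftAddHom_apply_single φ n a

variable (γ) in
/-- The product as a biadditive map; on generators, `(a uᵐ)(b uⁿ) = a γᵐ(b) uᵐ⁺ⁿ`. -/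
def mulHom : ConvAlgebra γ →+ ConvAlgebra γ →+ ConvAlgebra γ :=
  lift γ fun m : ℤ =>
    { toFun := fun a => lift γ fun n : ℤ =>
        { toFun := fun b => single γ (m + n) (a * (γ ^ m) b)
          map_zero' := by simp
          map_add' := by intro b c; simp [mul_add] }
      map_zero' := by
        refine addHom_ext fun n b => ?_
        rw [lift_single]
        simp
      map_add' := by
        intro a a'
        refine addHom_ext fun n b => ?_
        rw [AddMonoidHom.add_apply, lift_single, lift_single, lift_single]
        simp [add_mul] }

variable (γ) in
/-- The involution as an additive map; on generators, `(a uⁿ)⋆ = γ⁻ⁿ(a⋆) u⁻ⁿ`. -/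
def starHom : ConvAlgebra γ →+ ConvAlgebra γ :=
  lift γ fun n : ℤ =>
    { toFun := fun a => single γ (-n) ((γ ^ (-n)) (star a))
      map_zero' := by simp
      map_add' := by intro b c; simp }

instance : Mul (ConvAlgebra γ) := ⟨fun f g => mulHom γ f g⟩

instance : Star (ConvAlgebra γ) := ⟨fun f => starHom γ f⟩

lemma mul_def (f g : ConvAlgebra γ) : f * g = mulHom γ f g := rfl

lemma star_def (f : ConvAlgebra γ) : star f = starHom γ f := rfl

lemma single_mul_single (m n : ℤ) (a b : A) :
    single γ m a * single γ n b = single γ (m + n) (a * (γ ^ m) b) := by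
  rw [mul_def, mulHom, lift_single]
  exact lift_single _ n b

lemma star_single (n : ℤ) (a : A) :
    star (single γ n a) = single γ (-n) ((γ ^ (-n)) (star a)) := by
  rw [star_def, starHom]
  exact lift_single _ n a

@[elab_as_elim]
lemma induction_on {P : ConvAlgebra γ → Prop} (f : ConvAlgebra γ)
    (zero : P 0) (add : ∀ f g, P f → P g → P (f + g)) (one : ∀ n a, P (single γ n a)) : P f :=
  Finsupp.induction_linear f zero add one

lemma pow_apply_add (m n : ℤ) (a : A) : (γ ^ (m + n)) a = (γ ^ m) ((γ ^ n) a) := by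
  rw [zpow_add]; rfl

lemma left_distrib' (f g h : ConvAlgebra γ) : f * (g + h) = f * g + f * h := by
  simp [mul_def]

lemma right_distrib' (f g h : ConvAlgebra γ) : (f + g) * h = f * h + g * h := by
  simp [mul_def]

instance : NonUnitalRing (ConvAlgebra γ) where
  left_distrib := left_distrib'
  right_distrib := right_distrib'
  zero_mul f := by simp [mul_def]
  mul_zero f := by simp [mul_def]
  mul_assoc f g h := by
    have z₁ : ∀ f : ConvAlgebra γ, 0 * f = 0 := fun f => by simp [mul_def]
    have z₂ : ∀ f : ConvAlgebra γ, f * 0 = 0 := fun f => by simp [mul_def]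
    induction f using induction_on with
    | zero => simp [z₁]
    | add f f' h₁ h₂ => simp [right_distrib', h₁, h₂]
    | one k a =>
    induction g using induction_on with
    | zero => simp [z₁, z₂]
    | add f f' h₁ h₂ => simp [right_distrib', left_distrib', h₁, h₂]
    | one m b =>
    induction h using induction_on with
    | zero => simp [z₂]
    | add f f' h₁ h₂ => simp [left_distrib', h₁, h₂]
    | one n c =>
      simp only [single_mul_single, map_mul, pow_apply_add, mul_assoc, add_assoc]

instance : StarRing (ConvAlgebra γ) where
  star_involutive f := by
    induction f using induction_on with
    | zero => simp [star_def]
    | add f f' h₁ h₂ => simp only [star_def, map_add] at *; rw [h₁, h₂]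
    | one k a =>
      rw [star_single, star_single, ← map_star, star_star, ← pow_apply_add]
      simp
  star_add f g := by simp [star_def]
  star_mul f g := by
    have hs : ∀ f g : ConvAlgebra γ, star (f + g) = star f + star g := fun f g => by
      simp [star_def]
    have h0 : star (0 : ConvAlgebra γ) = 0 := by simp [star_def]
    induction f using induction_on with
    | zero => simp [h0]
    | add f f' h₁ h₂ => simp [hs, add_mul, mul_add, h₁, h₂]
    | one k a =>
    induction g using induction_on with
    | zero => simp [h0]
    | add f f' h₁ h₂ => simp [hs, add_mul, mul_add, h₁, h₂]
    | one m b =>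
      simp only [single_mul_single, star_single, star_mul, map_mul, neg_add_rev, pow_apply_add]
      congr 2
      rw [← map_star, ← pow_apply_add (-k) k]
      simp

instance : IsScalarTower ℂ (ConvAlgebra γ) (ConvAlgebra γ) where
  smul_assoc c f g := by
    simp only [smul_eq_mul]
    induction f using induction_on with
    | zero => simp
    | add f f' h₁ h₂ => simp [add_mul, h₁, h₂]
    | one k a =>
    induction g using induction_on with
    | zero => simp
    | add f f' h₁ h₂ => simp [mul_add, h₁, h₂]
    | one m b => rw [smul_single, single_mul_single, single_mul_single, smul_single, smul_mul_assoc]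

instance : SMulCommClass ℂ (ConvAlgebra γ) (ConvAlgebra γ) where
  smul_comm c f g := by
    simp only [smul_eq_mul]
    induction f using induction_on with
    | zero => simp
    | add f f' h₁ h₂ => simp [add_mul, h₁, h₂]
    | one k a =>
    induction g using induction_on with
    | zero => simp
    | add f f' h₁ h₂ => simp [mul_add, h₁, h₂]
    | one m b =>
      rw [smul_single, single_mul_single, single_mul_single, smul_single, map_smul (γ ^ k), mul_smul_comm]

instance : StarModule ℂ (ConvAlgebra γ) where
  star_smul c f := by
    induction f using induction_on with
    | zero => simp
    | add f f' h₁ h₂ => simp [h₁, h₂]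
    | one k a => simp [star_single, smul_single, star_smul]

/-- The norm `‖f‖₁ = ∑ₙ ‖f(n)‖`. -/
def l1Norm (f : ConvAlgebra γ) : ℝ := Finsupp.sum f fun _ a => ‖a‖

variable (γ) in
/-- The `‖·‖₁`-contractive C⋆-seminorms on `C_c(ℤ, A)`, i.e. the functions `f ↦ ‖π f‖` for `π` a
`‖·‖₁`-contractive ⋆-homomorphism from `C_c(ℤ, A)` to a C⋆-algebra. -/
def cstarSeminorms : Set (Seminorm ℂ (ConvAlgebra γ)) :=
  {p | (∀ f g, p (f * g) ≤ p f * p g) ∧ (∀ f, p (star f * f) = p f ^ 2) ∧ ∀ f, p f ≤ l1Norm f}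

variable (γ) in
/-- The universal C⋆-norm on `C_c(ℤ, A)`. -/
def maxSeminorm : Seminorm ℂ (ConvAlgebra γ) := sSup (cstarSeminorms γ)

lemma maxSeminorm_apply (f : ConvAlgebra γ) :
    maxSeminorm γ f = ⨆ p : cstarSeminorms γ, p.1 f := by
  rw [maxSeminorm, Seminorm.coe_sSup_eq', iSup_apply]
  refine ⟨l1Norm, ?_⟩
  rintro _ ⟨p, hp, rfl⟩
  exact hp.2.2

lemma bddAbove_cstarSeminorms (f : ConvAlgebra γ) :
    BddAbove (Set.range fun p : cstarSeminorms γ => p.1 f) :=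
  ⟨l1Norm f, by rintro _ ⟨p, rfl⟩; exact p.2.2.2 f⟩

lemma le_maxSeminorm {p : Seminorm ℂ (ConvAlgebra γ)} (hp : p ∈ cstarSeminorms γ)
    (f : ConvAlgebra γ) : p f ≤ maxSeminorm γ f := by
  rw [maxSeminorm_apply]
  exact le_ciSup (bddAbove_cstarSeminorms f) ⟨p, hp⟩

lemma l1Norm_nonneg (f : ConvAlgebra γ) : 0 ≤ l1Norm f :=
  Finset.sum_nonneg fun _ _ => norm_nonneg _

instance : Nonempty (cstarSeminorms γ) :=
  ⟨⟨0, by simp, by simp, fun f => l1Norm_nonneg f⟩⟩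

lemma maxSeminorm_mul_le (f g : ConvAlgebra γ) :
    maxSeminorm γ (f * g) ≤ maxSeminorm γ f * maxSeminorm γ g := by
  rw [maxSeminorm_apply (f * g)]
  refine ciSup_le fun p => (p.2.1 f g).trans ?_
  exact mul_le_mul (le_maxSeminorm p.2 f) (le_maxSeminorm p.2 g) (apply_nonneg _ _)
    (apply_nonneg _ _)

lemma sq_maxSeminorm_le (f : ConvAlgebra γ) :
    maxSeminorm γ f ^ 2 ≤ maxSeminorm γ (star f * f) := by
  have h : maxSeminorm γ f ≤ √(maxSeminorm γ (star f * f)) := by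
    rw [maxSeminorm_apply f]
    refine ciSup_le fun p => Real.le_sqrt_of_sq_le ?_
    rw [← p.2.2.1]
    exact le_maxSeminorm p.2 _
  calc maxSeminorm γ f ^ 2 ≤ √(maxSeminorm γ (star f * f)) ^ 2 := by gcongr
    _ = _ := Real.sq_sqrt (apply_nonneg _ _)

instance : NonUnitalSeminormedRing (ConvAlgebra γ) where
  __ := (inferInstance : NonUnitalRing (ConvAlgebra γ))
  __ := (maxSeminorm γ).toAddGroupSeminorm.toSeminormedAddCommGroup
  norm_mul_le := maxSeminorm_mul_le

lemma norm_def (f : ConvAlgebra γ) : ‖f‖ = maxSeminorm γ f := rfl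

instance : NormedSpace ℂ (ConvAlgebra γ) where
  norm_smul_le c f := (map_smul_eq_mul (maxSeminorm γ) c f).le

lemma norm_star_le (f : ConvAlgebra γ) : ‖star f‖ ≤ ‖f‖ := by
  have h : ‖star f‖ ^ 2 ≤ ‖f‖ * ‖star f‖ := by
    have := sq_maxSeminorm_le (star f)
    rw [star_star] at this
    exact this.trans (maxSeminorm_mul_le _ _)
  by_contra! hlt
  nlinarith [norm_nonneg f, norm_nonneg (star f)]

instance : NormedStarGroup (ConvAlgebra γ) where
  norm_star_le := norm_star_le

lemma norm_mul_self_le (f : ConvAlgebra γ) : ‖f‖ * ‖f‖ ≤ ‖star f * f‖ := by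
  rw [← pow_two]; exact sq_maxSeminorm_le f

end ConvAlgebra

end Conv

/-! ### The crossed product -/

section CrossedProduct

variable {A : Type*} [NonUnitalCStarAlgebra A]

/-- The (full) crossed product `A ⋊_γ ℤ`: the Hausdorff completion of `C_c(ℤ, A)` in the universal
C⋆-norm. -/
def CrossedProduct (γ : A ≃⋆ₐ[ℂ] A) : Type _ := Completion (ConvAlgebra γ)

namespace CrossedProduct

variable {γ : A ≃⋆ₐ[ℂ] A}

instance : NormedAddCommGroup (CrossedProduct γ) :=
  inferInstanceAs (NormedAddCommGroup (Completion (ConvAlgebra γ)))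

instance : NormedSpace ℂ (CrossedProduct γ) :=
  inferInstanceAs (NormedSpace ℂ (Completion (ConvAlgebra γ)))

instance : ContinuousConstSMul ℂ (CrossedProduct γ) :=
  inferInstanceAs (ContinuousConstSMul ℂ (Completion (ConvAlgebra γ)))

instance : CompleteSpace (CrossedProduct γ) :=
  inferInstanceAs (CompleteSpace (Completion (ConvAlgebra γ)))

variable (γ) in
/-- The canonical map `C_c(ℤ, A) → A ⋊_γ ℤ`. -/
def of : ConvAlgebra γ →ₗᵢ[ℂ] CrossedProduct γ := Completion.toComplₗᵢ

lemma isDenseInducing_of : IsDenseInducing (of γ) :=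
  Completion.isDenseInducing_coe (α := ConvAlgebra γ)

lemma denseRange_of : DenseRange (of γ) := isDenseInducing_of.dense

/-- The product is the continuous extension of the product of `C_c(ℤ, A)`. -/
instance : Mul (CrossedProduct γ) :=
  ⟨fun x y => (isDenseInducing_of.prodMap isDenseInducing_of).extend
    (fun z : ConvAlgebra γ × ConvAlgebra γ => of γ (z.1 * z.2)) (x, y)⟩

/-- The involution is the continuous extension of the involution of `C_c(ℤ, A)`. -/
instance : Star (CrossedProduct γ) :=
  ⟨isDenseInducing_of.extend fun f : ConvAlgebra γ => of γ (star f)⟩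

lemma of_mul (f g : ConvAlgebra γ) : of γ (f * g) = of γ f * of γ g :=
  ((isDenseInducing_of.prodMap isDenseInducing_of).extend_eq
    ((of γ).continuous.comp continuous_mul) (f, g)).symm

lemma of_star (f : ConvAlgebra γ) : of γ (star f) = star (of γ f) :=
  (isDenseInducing_of.extend_eq ((of γ).continuous.comp continuous_star) f).symm

lemma continuous_mul' : Continuous fun z : CrossedProduct γ × CrossedProduct γ =>
    z.1 * z.2 := by
  let m := (AddMonoidHom.mul : ConvAlgebra γ →+ ConvAlgebra γ →+ ConvAlgebra γ).compr₂
    (of γ).toLinearMap.toAddMonoidHom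
  have : Continuous fun p : ConvAlgebra γ × ConvAlgebra γ => m p.1 p.2 :=
    (of γ).continuous.comp continuous_mul
  have di : IsDenseInducing (of γ).toLinearMap.toAddMonoidHom := isDenseInducing_of
  exact di.extend_Z_bilin di this

instance : ContinuousMul (CrossedProduct γ) := ⟨continuous_mul'⟩

instance : ContinuousStar (CrossedProduct γ) where
  continuous_star := by
    have h : UniformContinuous fun f : ConvAlgebra γ => of γ (star f) :=
      (of γ).isometry.uniformContinuous.comp (uniformContinuous_of_continuousAt_zero
        (starAddEquiv : ConvAlgebra γ ≃+ ConvAlgebra γ).toAddMonoidHom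
          continuous_star.continuousAt)
    exact uniformContinuous_uniformly_extend (of γ).isometry.isUniformInducing denseRange_of h
      |>.continuous

lemma mul_add' (x y z : CrossedProduct γ) : x * (y + z) = x * y + x * z :=
  denseRange_of.induction_on₃ (p := fun x y z : CrossedProduct γ => x * (y + z) = x * y + x * z)
    (isClosed_eq (by fun_prop) (by fun_prop))
    (fun f g k => by simp only [← of_mul, ← map_add, mul_add]) x y z

lemma add_mul' (x y z : CrossedProduct γ) : (x + y) * z = x * z + y * z :=
  denseRange_of.induction_on₃ (p := fun x y z : CrossedProduct γ => (x + y) * z = x * z + y * z)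
    (isClosed_eq (by fun_prop) (by fun_prop))
    (fun f g k => by simp only [← of_mul, ← map_add, add_mul]) x y z

lemma mul_assoc' (x y z : CrossedProduct γ) : x * y * z = x * (y * z) :=
  denseRange_of.induction_on₃ (p := fun x y z : CrossedProduct γ => x * y * z = x * (y * z))
    (isClosed_eq (by fun_prop) (by fun_prop))
    (fun f g k => by simp only [← of_mul, mul_assoc]) x y z

lemma zero_mul' (x : CrossedProduct γ) : 0 * x = 0 :=
  denseRange_of.induction_on (p := fun x : CrossedProduct γ => 0 * x = 0) x
    (isClosed_eq (by fun_prop) (by fun_prop))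
    (fun f => by rw [← map_zero (of γ), ← of_mul, zero_mul])

lemma mul_zero' (x : CrossedProduct γ) : x * 0 = 0 :=
  denseRange_of.induction_on (p := fun x : CrossedProduct γ => x * 0 = 0) x
    (isClosed_eq (by fun_prop) (by fun_prop))
    (fun f => by rw [← map_zero (of γ), ← of_mul, mul_zero])

lemma norm_mul_le' (x y : CrossedProduct γ) : ‖x * y‖ ≤ ‖x‖ * ‖y‖ :=
  denseRange_of.induction_on₂ (p := fun x y : CrossedProduct γ => ‖x * y‖ ≤ ‖x‖ * ‖y‖)
    (isClosed_le (by fun_prop) (by fun_prop))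
    (fun f g => by simpa only [← of_mul, (of γ).norm_map] using norm_mul_le f g) x y

lemma star_star' (x : CrossedProduct γ) : star (star x) = x :=
  denseRange_of.induction_on (p := fun x : CrossedProduct γ => star (star x) = x) x
    (isClosed_eq (by fun_prop) (by fun_prop))
    (fun f => by simp only [← of_star, star_star])

lemma star_add' (x y : CrossedProduct γ) : star (x + y) = star x + star y :=
  denseRange_of.induction_on₂ (p := fun x y : CrossedProduct γ => star (x + y) = star x + star y)
    (isClosed_eq (by fun_prop) (by fun_prop))
    (fun f g => by simp only [← of_star, ← map_add, star_add]) x y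

lemma star_mul' (x y : CrossedProduct γ) : star (x * y) = star y * star x :=
  denseRange_of.induction_on₂ (p := fun x y : CrossedProduct γ => star (x * y) = star y * star x)
    (isClosed_eq (by fun_prop) (by fun_prop))
    (fun f g => by simp only [← of_star, ← of_mul, star_mul]) x y

lemma norm_mul_self_le' (x : CrossedProduct γ) : ‖x‖ * ‖x‖ ≤ ‖star x * x‖ :=
  denseRange_of.induction_on (p := fun x : CrossedProduct γ => ‖x‖ * ‖x‖ ≤ ‖star x * x‖) x
    (isClosed_le (by fun_prop) (by fun_prop))
    (fun f => by
      simpa only [← of_mul, ← of_star, (of γ).norm_map] using ConvAlgebra.norm_mul_self_le f)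

lemma continuous_smul' (c : ℂ) : Continuous fun x : CrossedProduct γ => c • x :=
  continuous_const_smul c

lemma smul_mul' (c : ℂ) (x y : CrossedProduct γ) : (c • x) * y = c • (x * y) :=
  denseRange_of.induction_on₂ (p := fun x y : CrossedProduct γ => (c • x) * y = c • (x * y))
    (isClosed_eq (((continuous_smul' c).comp continuous_fst).mul continuous_snd)
      ((continuous_smul' c).comp continuous_mul'))
    (fun f g => by simp only [← of_mul, ← map_smul, smul_mul_assoc]) x y

lemma mul_smul' (c : ℂ) (x y : CrossedProduct γ) : c • (x * y) = x * (c • y) :=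
  denseRange_of.induction_on₂ (p := fun x y : CrossedProduct γ => c • (x * y) = x * (c • y))
    (isClosed_eq ((continuous_smul' c).comp continuous_mul')
      (continuous_fst.mul ((continuous_smul' c).comp continuous_snd)))
    (fun f g => by simp only [← of_mul, ← map_smul, mul_smul_comm]) x y

lemma star_smul' (c : ℂ) (x : CrossedProduct γ) : star (c • x) = star c • star x :=
  denseRange_of.induction_on (p := fun x : CrossedProduct γ => star (c • x) = star c • star x) x
    (isClosed_eq (continuous_star.comp (continuous_smul' c))
      ((continuous_smul' (star c)).comp continuous_star))
    (fun f => by simp only [← of_star, ← map_smul, star_smul])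

instance : NonUnitalNormedRing (CrossedProduct γ) where
  __ := (inferInstance : NormedAddCommGroup (CrossedProduct γ))
  __ := (inferInstance : Mul (CrossedProduct γ))
  left_distrib := mul_add'
  right_distrib := add_mul'
  zero_mul := zero_mul'
  mul_zero := mul_zero'
  mul_assoc := mul_assoc'
  norm_mul_le := norm_mul_le'

instance : StarRing (CrossedProduct γ) where
  star_involutive := star_star'
  star_add := star_add'
  star_mul := star_mul'

instance : NonUnitalCStarAlgebra (CrossedProduct γ) where
  __ := (inferInstance : NormedSpace ℂ (CrossedProduct γ))
  norm_mul_self_le := norm_mul_self_le'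
  smul_assoc := smul_mul'
  smul_comm := mul_smul'
  star_smul := star_smul'

instance : PartialOrder (CrossedProduct γ) := CStarAlgebra.spectralOrder _

instance : StarOrderedRing (CrossedProduct γ) := CStarAlgebra.spectralOrderedRing _

variable (γ) in
/-- The canonical embedding `A → A ⋊_γ ℤ`, `a ↦ a u⁰`. -/
def ι : A →⋆ₙₐ[ℂ] CrossedProduct γ where
  toFun a := of γ (ConvAlgebra.single γ 0 a)
  map_smul' c a := by simp [← ConvAlgebra.smul_single]
  map_zero' := by simp
  map_add' a b := by simp
  map_mul' a b := by simp [← of_mul, ConvAlgebra.single_mul_single]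
  map_star' a := by simp [← of_star, ConvAlgebra.star_single]

variable (γ) in
/-- The restriction to `A₊` of a map on the positive cone of `A ⋊_γ ℤ`. -/
def restrict [PartialOrder A] [StarOrderedRing A] (τ : {x : CrossedProduct γ // 0 ≤ x} → ℝ≥0∞) :
    {a : A // 0 ≤ a} → ℝ≥0∞ :=
  fun a => τ ⟨ι γ a.1, map_nonneg (ι γ) a.2⟩

end CrossedProduct

end CrossedProduct

end

/-! Write `E` for the conditional expectation of the crossed product onto `A`, that is, `coeffL 0`.

Surjectivity does not use the Rokhlin condition: the extension of an invariant `σ` is `σ ∘ E`.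
Parseval's identity `E(xx⋆) = ∑ₙ xₙxₙ⋆` (`hasSum_coeffL_mul_star`), together with the countable
additivity that lower semicontinuity gives (`coneExt_hasSum`), reduces the trace identity for `σ ∘
E` to that of `σ` on each Fourier coefficient; invariance absorbs the power of `γ` in the
coefficients of `x⋆`. That coefficients are bounded in the universal norm is read off from the
regular representation.

For injectivity, projections have finite trace (`coneExt_projection_lt_top`), so inside the corner
of a projection `q` a norm error `c` costs at most `c τ(q)`. Let `x`, `y` lie in such a corner with
`E(x) = E(y)`. Then `x - y` is close to a finite sum `f` of terms `aₙuⁿ` with `n ≠ 0`. Rokhlin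
towers longer than every `|n|` that occurs give positive `gᵢ` with sum close to `q` and `gᵢ aₙ
γⁿ(gᵢ)` small, so each `√gᵢ f √gᵢ` is small (`exists_almost_partition`). The trace identity gives
`∑ᵢ τ(√gᵢ x √gᵢ) = τ(√x (∑ᵢ gᵢ) √x) ≈ τ(x)`, and similarly for `y`; hence `τ(x) = τ(y)`
(`coneExt_le_of_coeffL_zero_eq`). Taking `y = E(x)` shows that `τ` is determined on corners by its
restriction, and lower semicontinuity along the `q r` does the rest (`coneExt_le_of_corners`). -/

noncomputable section

/-! ### Traces, corners of projections and lower semicontinuity -/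

section TraceTheory

variable {A : Type*} [NonUnitalCStarAlgebra A] [PartialOrder A] [StarOrderedRing A]

lemma star_sqrt (a : A) : star (CFC.sqrt a) = CFC.sqrt a :=
  (IsSelfAdjoint.of_nonneg (CFC.sqrt_nonneg a)).star_eq

/-- The C⋆-identity turns the left side into the norm of `c⋆ac`. This transfers smallness from a
positive element to its square root. -/
lemma norm_sqrt_mul_sq_le {a : A} (ha : 0 ≤ a) (c : A) :
    ‖CFC.sqrt a * c‖ ^ 2 ≤ ‖c‖ * ‖a * c‖ := by
  have h : star (CFC.sqrt a * c) * (CFC.sqrt a * c) = star c * (a * c) := by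
    conv_rhs => rw [← CFC.sqrt_mul_sqrt_self a ha]
    simp only [star_mul, star_sqrt, mul_assoc]
  rw [pow_two, ← CStarRing.norm_star_mul_self, h]
  exact (norm_mul_le _ _).trans_eq (by rw [norm_star])

/-- The value of `τ` at `a`, extended by zero off the positive cone. -/
def coneExt (τ : {a : A // 0 ≤ a} → ℝ≥0∞) (a : A) : ℝ≥0∞ :=
  open Classical in if h : 0 ≤ a then τ ⟨a, h⟩ else 0

omit [StarOrderedRing A] in
lemma coneExt_of_nonneg (τ : {a : A // 0 ≤ a} → ℝ≥0∞) {a : A} (ha : 0 ≤ a) :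
    coneExt τ a = τ ⟨a, ha⟩ := dif_pos ha

lemma sqrt_mul_eq_self_of_mul_eq {a q : A} (ha : 0 ≤ a) (h : a * q = a) (hq : IsSelfAdjoint q) :
    CFC.sqrt a * q = CFC.sqrt a := by
  have h' : q * a = a := by
    have := congrArg star h
    rwa [star_mul, hq.star_eq, (IsSelfAdjoint.of_nonneg ha).star_eq] at this
  rw [← sub_eq_zero, ← norm_eq_zero, ← mul_self_eq_zero, ← CStarRing.norm_star_mul_self]
  have : star (CFC.sqrt a * q - CFC.sqrt a) * (CFC.sqrt a * q - CFC.sqrt a) =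
      q * (CFC.sqrt a * CFC.sqrt a) * q - q * (CFC.sqrt a * CFC.sqrt a)
        - (CFC.sqrt a * CFC.sqrt a) * q + CFC.sqrt a * CFC.sqrt a := by
    simp only [star_sub, star_mul, star_sqrt, hq.star_eq]
    noncomm_ring
  rw [this, CFC.sqrt_mul_sqrt_self a ha, h', h]
  simp

lemma sqrt_conj_nonneg (a : A) {b : A} (hb : 0 ≤ b) : 0 ≤ CFC.sqrt a * b * CFC.sqrt a :=
  conjugate_nonneg_of_nonneg hb (CFC.sqrt_nonneg a)

lemma sqrt_conj_le_smul {a b : A} (ha : 0 ≤ a) (hb : IsSelfAdjoint b) :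
    CFC.sqrt a * b * CFC.sqrt a ≤ ‖b‖ • a := by
  have := CStarAlgebra.star_left_conjugate_le_norm_smul (a := CFC.sqrt a) (b := b) hb
  rwa [star_sqrt, CFC.sqrt_mul_sqrt_self a ha] at this

lemma sqrt_conj_le_smul_of_norm_le {a b : A} (ha : 0 ≤ a) (hb : IsSelfAdjoint b) {c : ℝ}
    (hc : ‖b‖ ≤ c) : CFC.sqrt a * b * CFC.sqrt a ≤ c • a :=
  (sqrt_conj_le_smul ha hb).trans (smul_le_smul_of_nonneg_right hc ha)

/-- In its corner `q` acts as a unit, so norm bounds become order bounds to which a trace can be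
applied. -/
lemma le_smul_of_corner {q a : A} (hq : IsStarProjection q) (ha : IsSelfAdjoint a)
    (h : q * a * q = a) {c : ℝ} (hc : ‖a‖ ≤ c) : a ≤ c • q := by
  have := CStarAlgebra.star_left_conjugate_le_norm_smul (a := q) (b := a) ha
  rw [hq.isSelfAdjoint.star_eq, h, hq.isIdempotentElem.eq] at this
  exact this.trans (smul_le_smul_of_nonneg_right hc hq.nonneg)

namespace IsTrace

variable {τ : {a : A // 0 ≤ a} → ℝ≥0∞} (hτ : IsTrace τ)
include hτ

lemma coneExt_add {a b : A} (ha : 0 ≤ a) (hb : 0 ≤ b) :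
    coneExt τ (a + b) = coneExt τ a + coneExt τ b := by
  rw [coneExt_of_nonneg τ ha, coneExt_of_nonneg τ hb, coneExt_of_nonneg τ (add_nonneg ha hb)]
  exact hτ.map_add a b ha hb

lemma coneExt_smul {c : ℝ} (hc : 0 ≤ c) {a : A} (ha : 0 ≤ a) :
    coneExt τ (c • a) = ENNReal.ofReal c * coneExt τ a := by
  lift c to ℝ≥0 using hc
  rw [coneExt_of_nonneg τ ha, coneExt_of_nonneg τ (smul_nonneg c.coe_nonneg ha),
    ENNReal.ofReal_coe_nnreal]
  exact hτ.map_smul c a ha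

lemma coneExt_zero : coneExt τ 0 = 0 := by
  simpa using hτ.coneExt_smul le_rfl (le_refl (0 : A))

lemma coneExt_sum {ι : Type*} (s : Finset ι) {a : ι → A} (ha : ∀ i ∈ s, 0 ≤ a i) :
    coneExt τ (∑ i ∈ s, a i) = ∑ i ∈ s, coneExt τ (a i) := by
  classical
  induction s using Finset.induction_on with
  | empty => simpa using hτ.coneExt_zero
  | insert i s hi ih =>
    have hs : ∀ j ∈ s, 0 ≤ a j := fun j hj => ha j (Finset.mem_insert_of_mem hj)
    rw [Finset.sum_insert hi, Finset.sum_insert hi, ← ih hs,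
      hτ.coneExt_add (ha i (Finset.mem_insert_self i s)) (Finset.sum_nonneg hs)]

lemma coneExt_mono {a b : A} (ha : 0 ≤ a) (hab : a ≤ b) : coneExt τ a ≤ coneExt τ b := by
  rw [← add_sub_cancel a b, hτ.coneExt_add ha (sub_nonneg.2 hab)]
  exact le_self_add

lemma coneExt_star_mul_self (x : A) : coneExt τ (star x * x) = coneExt τ (x * star x) := by
  rw [coneExt_of_nonneg τ (star_mul_self_nonneg x), coneExt_of_nonneg τ (mul_star_self_nonneg x)]
  exact hτ.map_star_mul_self x

/-- This is the trace identity for the element `√b √a`. -/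
lemma coneExt_sqrt_conj {a b : A} (ha : 0 ≤ a) (hb : 0 ≤ b) :
    coneExt τ (CFC.sqrt a * b * CFC.sqrt a) = coneExt τ (CFC.sqrt b * a * CFC.sqrt b) := by
  have := hτ.coneExt_star_mul_self (CFC.sqrt b * CFC.sqrt a)
  rw [star_mul, star_sqrt, star_sqrt, mul_assoc, ← mul_assoc (CFC.sqrt b),
    CFC.sqrt_mul_sqrt_self b hb, mul_assoc (CFC.sqrt b), ← mul_assoc (CFC.sqrt a) (CFC.sqrt a),
    CFC.sqrt_mul_sqrt_self a ha] at this
  simpa only [mul_assoc] using this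

lemma coneExt_projection_conj {q a : A} (hq : IsStarProjection q) (ha : 0 ≤ a) :
    coneExt τ (CFC.sqrt a * q * CFC.sqrt a) = coneExt τ (q * a * q) := by
  rw [hτ.coneExt_sqrt_conj ha hq.nonneg, CFC.sqrt_unique hq.isIdempotentElem.eq hq.nonneg]

lemma coneExt_projection_conj_le {q a : A} (hq : IsStarProjection q) (ha : 0 ≤ a) :
    coneExt τ (q * a * q) ≤ coneExt τ a := by
  rw [← hτ.coneExt_projection_conj hq ha]
  refine hτ.coneExt_mono (sqrt_conj_nonneg a hq.nonneg) ?_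
  simpa using sqrt_conj_le_smul_of_norm_le ha hq.isSelfAdjoint hq.norm_le

lemma coneExt_le_add_of_corner {q x y : A} (hq : IsStarProjection q) (hx : 0 ≤ x) (hy : 0 ≤ y)
    (hx' : q * x * q = x) (hy' : q * y * q = y) {c : ℝ} (hc : ‖x - y‖ ≤ c) :
    coneExt τ x ≤ coneExt τ y + ENNReal.ofReal c * coneExt τ q := by
  have hc0 : 0 ≤ c := (norm_nonneg _).trans hc
  have h : x - y ≤ c • q := le_smul_of_corner hq
    ((IsSelfAdjoint.of_nonneg hx).sub (.of_nonneg hy)) (by rw [mul_sub, sub_mul, hx', hy']) hc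
  rw [← hτ.coneExt_smul hc0 hq.nonneg, ← hτ.coneExt_add hy (smul_nonneg hc0 hq.nonneg)]
  exact hτ.coneExt_mono hx (by rwa [sub_le_iff_le_add'] at h)

end IsTrace

namespace IsDenselyDefinedLSCTrace

variable {τ : {a : A // 0 ≤ a} → ℝ≥0∞}

/-- If `b` has finite trace and is within `1/2` of `q`, then `qbq ≥ q/2` in the corner, so `τ(q) ≤
2τ(qbq) ≤ 2τ(b)`. -/
lemma coneExt_projection_lt_top (hτ : IsDenselyDefinedLSCTrace τ) {q : A}
    (hq : IsStarProjection q) : coneExt τ q < ∞ := by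
  obtain ⟨⟨b, hb⟩, hbτ, hbq⟩ := hτ.dense_domain.exists_dist_lt ⟨q, hq.nonneg⟩
    (by norm_num : (0 : ℝ) < 1 / 2)
  rw [Subtype.dist_eq, dist_eq_norm] at hbq
  have hqs := hq.isSelfAdjoint
  have hqbq : 0 ≤ q * b * q := conjugate_nonneg_of_nonneg hb hq.nonneg
  have h1 : q * (q - b) * q ≤ (1 / 2 : ℝ) • q := by
    have := CStarAlgebra.star_left_conjugate_le_norm_smul (a := q) (b := q - b)
      (hqs.sub (.of_nonneg hb))
    rw [hqs.star_eq, hq.isIdempotentElem.eq] at this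
    exact this.trans (smul_le_smul_of_nonneg_right hbq.le hq.nonneg)
  have h2 : q ≤ (2 : ℝ) • (q * b * q) := by
    have h3 : q * (q - b) * q = q - q * b * q := by
      rw [mul_sub, sub_mul, hq.isIdempotentElem.eq, hq.isIdempotentElem.eq]
    rw [h3, sub_le_iff_le_add] at h1
    have h4 := smul_le_smul_of_nonneg_left h1 (by norm_num : (0 : ℝ) ≤ 2)
    rw [smul_add, smul_smul, two_smul ℝ q] at h4
    norm_num at h4
    exact h4
  have h5 : coneExt τ b < ∞ := by rw [coneExt_of_nonneg τ hb]; exact hbτ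
  calc coneExt τ q ≤ coneExt τ ((2 : ℝ) • (q * b * q)) := hτ.coneExt_mono hq.nonneg h2
    _ = ENNReal.ofReal 2 * coneExt τ (q * b * q) := hτ.coneExt_smul (by norm_num) hqbq
    _ ≤ ENNReal.ofReal 2 * coneExt τ b := by
        gcongr; exact hτ.coneExt_projection_conj_le hq hb
    _ < ∞ := ENNReal.mul_lt_top ENNReal.ofReal_lt_top h5

omit [StarOrderedRing A] in
lemma coneExt_le_of_tendsto (hτ : LowerSemicontinuous τ) {ι : Type*} {l : Filter ι} [l.NeBot]
    {u : ι → A} {a : A} (hu : ∀ i, 0 ≤ u i) (ha : 0 ≤ a) (h : Tendsto u l (𝓝 a)) {C : ℝ≥0∞}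
    (hC : ∀ i, coneExt τ (u i) ≤ C) : coneExt τ a ≤ C := by
  refine le_of_forall_lt fun c hc => ?_
  rw [coneExt_of_nonneg τ ha] at hc
  have h' : Tendsto (fun i => (⟨u i, hu i⟩ : {a : A // 0 ≤ a})) l (𝓝 ⟨a, ha⟩) :=
    tendsto_subtype_rng.2 h
  obtain ⟨i, hi⟩ := (h'.eventually (hτ ⟨a, ha⟩ c hc)).exists
  rw [← coneExt_of_nonneg τ] at hi
  exact hi.trans_le (hC i)

/-- Lower semicontinuity along the partial sums gives `≤`; the partial sums lie below `a`, which
gives `≥`. -/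
lemma coneExt_hasSum (hτ : IsDenselyDefinedLSCTrace τ) {ι : Type*} {u : ι → A} {a : A}
    (hu : ∀ i, 0 ≤ u i) (h : HasSum u a) : coneExt τ a = ∑' i, coneExt τ (u i) := by
  have hs : ∀ s : Finset ι, 0 ≤ ∑ i ∈ s, u i := fun s => Finset.sum_nonneg fun i _ => hu i
  have hc : IsClosed {x : A | 0 ≤ x} := CStarAlgebra.isClosed_nonneg
  have ha : 0 ≤ a := hc.mem_of_tendsto h (Eventually.of_forall hs)
  refine le_antisymm ?_ ?_
  · refine coneExt_le_of_tendsto hτ.lowerSemicontinuous hs ha h fun s => ?_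
    rw [hτ.coneExt_sum s fun i _ => hu i]
    exact ENNReal.sum_le_tsum s
  · rw [ENNReal.tsum_eq_iSup_sum]
    refine iSup_le fun s => ?_
    rw [← hτ.coneExt_sum s fun i _ => hu i]
    refine hτ.coneExt_mono (hs s) (sub_nonneg.1 ?_)
    have h' : Tendsto (fun t : Finset ι => ∑ i ∈ t, u i) atTop (𝓝 a) := h
    refine hc.mem_of_tendsto (h'.sub tendsto_const_nhds) ?_
    filter_upwards [eventually_ge_atTop s] with t ht
    exact sub_nonneg.2 (Finset.sum_le_sum_of_subset_of_nonneg ht fun i _ _ => hu i)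

lemma tendsto_sqrt_conj {q : ℕ → A} (hq : ∀ a, Tendsto (fun r => q r * a) atTop (𝓝 a)) {a : A}
    (ha : 0 ≤ a) : Tendsto (fun r => CFC.sqrt a * q r * CFC.sqrt a) atTop (𝓝 a) := by
  have := (tendsto_const_nhds (x := CFC.sqrt a)).mul (hq (CFC.sqrt a))
  rw [CFC.sqrt_mul_sqrt_self a ha] at this
  simpa only [mul_assoc] using this

/-- The elements `√a q_r √a` converge to `a` and have the same trace as `q_r a q_r`, while
compression by `q_r` does not increase `τ'`. -/
lemma coneExt_le_of_corners {τ' : {a : A // 0 ≤ a} → ℝ≥0∞} (hτ : IsDenselyDefinedLSCTrace τ)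
    (hτ' : IsTrace τ') {q : ℕ → A} (hq : ∀ r, IsStarProjection (q r))
    (hq' : ∀ a, Tendsto (fun r => q r * a) atTop (𝓝 a)) {a : A} (ha : 0 ≤ a)
    (h : ∀ r, coneExt τ (q r * a * q r) ≤ coneExt τ' (q r * a * q r)) :
    coneExt τ a ≤ coneExt τ' a := by
  refine coneExt_le_of_tendsto hτ.lowerSemicontinuous
    (fun r => sqrt_conj_nonneg a (hq r).nonneg) ha (tendsto_sqrt_conj hq' ha) fun r => ?_
  rw [hτ.coneExt_projection_conj (hq r) ha]
  exact (h r).trans (hτ'.coneExt_projection_conj_le (hq r) ha)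

end IsDenselyDefinedLSCTrace

/-- A lower semicontinuous trace which is finite on an approximate unit of projections is densely
defined. -/
lemma IsTrace.dense_domain_of_projections {τ : {a : A // 0 ≤ a} → ℝ≥0∞} (hτ : IsTrace τ)
    {q : ℕ → A} (hq : ∀ r, IsStarProjection (q r))
    (hq' : ∀ a, Tendsto (fun r => q r * a) atTop (𝓝 a)) (hfin : ∀ r, coneExt τ (q r) < ∞) :
    Dense {a : {a : A // 0 ≤ a} | τ a < ∞} := by
  rintro ⟨a, ha⟩
  have h0 : ∀ r, 0 ≤ CFC.sqrt a * q r * CFC.sqrt a := fun r => sqrt_conj_nonneg a (hq r).nonneg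
  refine mem_closure_of_tendsto (b := atTop)
    (f := fun r => (⟨CFC.sqrt a * q r * CFC.sqrt a, h0 r⟩ : {a : A // 0 ≤ a}))
    (tendsto_subtype_rng.2 (IsDenselyDefinedLSCTrace.tendsto_sqrt_conj hq' ha))
    (Eventually.of_forall fun r => ?_)
  rw [Set.mem_ofPred_eq, ← coneExt_of_nonneg τ, hτ.coneExt_projection_conj (hq r) ha]
  have h1 : q r * a * q r ≤ ‖a‖ • q r := by
    have := CStarAlgebra.star_left_conjugate_le_norm_smul (a := q r) (b := a) (.of_nonneg ha)
    rwa [(hq r).isSelfAdjoint.star_eq, (hq r).isIdempotentElem.eq] at this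
  refine (hτ.coneExt_mono (conjugate_nonneg_of_nonneg ha (hq r).nonneg) h1).trans_lt ?_
  rw [hτ.coneExt_smul (norm_nonneg a) (hq r).nonneg]
  exact ENNReal.mul_lt_top ENNReal.ofReal_lt_top (hfin r)

end TraceTheory

/-! ### Fourier coefficients on `C_c(ℤ, A)` and the regular representation -/

section Coefficients

namespace ConvAlgebra

variable {A : Type*} [NonUnitalCStarAlgebra A] {γ : A ≃⋆ₐ[ℂ] A}

/-- The coefficient of `uⁿ` in an element of `C_c(ℤ, A)`. -/
def coeff (n : ℤ) : ConvAlgebra γ →ₗ[ℂ] A := Finsupp.lapply (M := A) n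

/-- The set of `n` for which the coefficient of `uⁿ` does not vanish. -/
def supp (f : ConvAlgebra γ) : Finset ℤ := Finsupp.support (M := A) f

lemma coeff_eq_zero {f : ConvAlgebra γ} {n : ℤ} (h : n ∉ supp f) : coeff n f = 0 :=
  Finsupp.notMem_support_iff.1 h

lemma coeff_single (m n : ℤ) (a : A) : coeff n (single γ m a) = if m = n then a else 0 :=
  Finsupp.single_apply

lemma coeff_single_self (n : ℤ) (a : A) : coeff n (single γ n a) = a := by
  rw [coeff_single, if_pos rfl]

lemma sum_single (f : ConvAlgebra γ) : ∑ n ∈ supp f, single γ n (coeff n f) = f :=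
  Finsupp.sum_single f

lemma l1Norm_eq (f : ConvAlgebra γ) : l1Norm f = ∑ n ∈ supp f, ‖coeff n f‖ := rfl

lemma coeff_single_zero_mul (n : ℤ) (a : A) (f : ConvAlgebra γ) :
    coeff n (single γ 0 a * f) = a * coeff n f := by
  induction f using induction_on with
  | zero => simp
  | add f g hf hg => simp only [mul_add, map_add, hf, hg]
  | one m b =>
    rw [single_mul_single, coeff_single, coeff_single, zero_add, zpow_zero]
    split_ifs <;> simp

lemma coeff_mul_single_zero (n : ℤ) (a : A) (f : ConvAlgebra γ) :
    coeff n (f * single γ 0 a) = coeff n f * (γ ^ n) a := by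
  induction f using induction_on with
  | zero => simp
  | add f g hf hg => simp only [add_mul, map_add, hf, hg]
  | one m b =>
    rw [single_mul_single, coeff_single, coeff_single, add_zero]
    split_ifs with h
    · rw [h]
    · simp

lemma coeff_star (n : ℤ) (f : ConvAlgebra γ) :
    coeff n (star f) = (γ ^ n) (star (coeff (-n) f)) := by
  induction f using induction_on with
  | zero => simp
  | add f g hf hg => simp only [star_add, map_add, hf, hg]
  | one m b =>
    rw [star_single, coeff_single, coeff_single]
    by_cases h : -m = n
    · subst h; simp
    · rw [if_neg h, if_neg (by omega)]; simp

lemma coeff_zero_single_mul_star (n : ℤ) (a : A) (g : ConvAlgebra γ) :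
    coeff 0 (single γ n a * star g) = a * star (coeff n g) := by
  induction g using induction_on with
  | zero => simp
  | add f g hf hg => simp only [star_add, mul_add, map_add, hf, hg]
  | one m b =>
    rw [star_single, single_mul_single, coeff_single, coeff_single]
    by_cases h : m = n
    · subst h
      rw [if_pos (by omega), if_pos rfl, ← pow_apply_add]
      simp
    · rw [if_neg h, if_neg (by omega)]; simp

/-- Allowing any finite set containing the support of `f` lets sums for different elements be
compared over a common index set. -/
lemma coeff_zero_mul_star {f : ConvAlgebra γ} {s : Finset ℤ} (hs : supp f ⊆ s)
    (g : ConvAlgebra γ) :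
    coeff 0 (f * star g) = ∑ n ∈ s, coeff n f * star (coeff n g) := by
  rw [← Finset.sum_subset hs fun n _ hn => by rw [coeff_eq_zero hn, zero_mul]]
  conv_lhs => rw [← sum_single f]
  rw [Finset.sum_mul, map_sum]
  exact Finset.sum_congr rfl fun n _ => coeff_zero_single_mul_star n _ g

section Order

variable [PartialOrder A] [StarOrderedRing A]

lemma sum_coeff_mul_star_le (f : ConvAlgebra γ) (s : Finset ℤ) :
    ∑ n ∈ s, coeff n f * star (coeff n f) ≤ coeff 0 (f * star f) := by
  rw [coeff_zero_mul_star (Finset.subset_union_right (s₁ := s))]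
  exact Finset.sum_le_sum_of_subset_of_nonneg Finset.subset_union_left
    fun n _ _ => mul_star_self_nonneg _

lemma coeff_zero_mul_star_self_nonneg (f : ConvAlgebra γ) : 0 ≤ coeff 0 (f * star f) := by
  simpa using sum_coeff_mul_star_le f ∅

lemma norm_coeff_sq_le (f : ConvAlgebra γ) (n : ℤ) :
    ‖coeff n f‖ ^ 2 ≤ ‖coeff 0 (f * star f)‖ := by
  rw [pow_two, ← CStarRing.norm_self_mul_star]
  refine CStarAlgebra.norm_le_norm_of_nonneg_of_le (mul_star_self_nonneg _) ?_
  simpa using sum_coeff_mul_star_le f {n}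

lemma norm_zpow_apply (n : ℤ) (a : A) : ‖(γ ^ n) a‖ = ‖a‖ := by
  exact StarAlgEquiv.norm_map (γ ^ n) a

end Order

variable (γ) in
/-- `C_c(ℤ, A)` as a left inner product `A`-module. -/
def RegularModule : Type _ := ConvAlgebra γ

namespace RegularModule

variable [PartialOrder A] [StarOrderedRing A]

instance : AddCommGroup (RegularModule γ) := inferInstanceAs (AddCommGroup (ConvAlgebra γ))

instance : Module ℂ (RegularModule γ) := inferInstanceAs (Module ℂ (ConvAlgebra γ))

variable (γ) in
/-- The identity, as a linear map to the regular module. -/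
def mk : ConvAlgebra γ ≃ₗ[ℂ] RegularModule γ := LinearEquiv.refl ℂ (ConvAlgebra γ)

instance : SMul A (RegularModule γ) := ⟨fun a x => mk γ (single γ 0 a * (mk γ).symm x)⟩

/-- The order of the factors makes this linear in the second variable for left multiplication by
`A`. Positivity and definiteness come from `E(ff⋆) = ∑ₙ f(n)f(n)⋆`. -/
instance : Inner A (RegularModule γ) :=
  ⟨fun x y => coeff 0 ((mk γ).symm y * star ((mk γ).symm x))⟩

omit [PartialOrder A] [StarOrderedRing A] in
lemma inner_def (x y : RegularModule γ) :
    inner A x y = coeff 0 ((mk γ).symm y * star ((mk γ).symm x)) := rfl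

instance instNorm : Norm (RegularModule γ) := CStarModule.norm A

instance instCStarModule : CStarModule A (RegularModule γ) where
  inner_add_right {x y z} := by simp only [inner_def, map_add, add_mul]
  inner_self_nonneg {x} := coeff_zero_mul_star_self_nonneg _
  inner_self {x} := by
    refine ⟨fun h => ?_, fun h => by simp [h, inner_def]⟩
    rw [← (mk γ).symm.map_eq_zero_iff, ← sum_single ((mk γ).symm x)]
    refine Finset.sum_eq_zero fun n _ => ?_
    have := norm_coeff_sq_le ((mk γ).symm x) n
    rw [← inner_def, h, norm_zero] at this
    have h0 : coeff n ((mk γ).symm x) = 0 := norm_eq_zero.1 <|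
      pow_eq_zero_iff two_ne_zero |>.1 (le_antisymm this (sq_nonneg _))
    rw [h0, map_zero]
  inner_op_smul_right {a x y} := by
    change coeff 0 (single γ 0 a * (mk γ).symm y * star ((mk γ).symm x)) = _
    rw [mul_assoc, coeff_single_zero_mul]
    rfl
  inner_smul_right_complex {z x y} := by simp only [inner_def, map_smul, smul_mul_assoc]
  star_inner x y := by
    have := coeff_star 0 ((mk γ).symm y * star ((mk γ).symm x))
    rw [star_mul, star_star] at this
    simpa [inner_def] using this.symm
  norm_eq_sqrt_norm_inner_self x := rfl

instance : NormedAddCommGroup (RegularModule γ) := CStarModule.normedAddCommGroup A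

instance : NormedSpace ℂ (RegularModule γ) := .ofCore (CStarModule.normedSpaceCore A)

lemma norm_sq_mk (f : ConvAlgebra γ) : ‖mk γ f‖ ^ 2 = ‖coeff 0 (f * star f)‖ :=
  CStarModule.norm_sq_eq A

lemma norm_coeff_zero_mul_star_le (f g : ConvAlgebra γ) :
    ‖coeff 0 (f * star g)‖ ≤ ‖mk γ f‖ * ‖mk γ g‖ := by
  rw [mul_comm]
  exact CStarModule.norm_inner_le (A := A) (RegularModule γ) (x := mk γ g) (y := mk γ f)

lemma norm_coeff_le (f : ConvAlgebra γ) (n : ℤ) : ‖coeff n f‖ ≤ ‖mk γ f‖ :=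
  le_of_pow_le_pow_left₀ two_ne_zero (norm_nonneg _)
    ((norm_coeff_sq_le f n).trans_eq (norm_sq_mk f).symm)

/-- Since `uⁿ` cancels, the squared norm is that of `∑ₘ f(m) γᵐ(aa⋆) f(m)⋆`, whose terms are at most
`‖a‖² f(m)f(m)⋆`. -/
lemma norm_mk_mul_single_le (f : ConvAlgebra γ) (n : ℤ) (a : A) :
    ‖mk γ (f * single γ n a)‖ ≤ ‖a‖ * ‖mk γ f‖ := by
  refine le_of_pow_le_pow_left₀ two_ne_zero (by positivity) ?_
  have h1 : f * single γ n a * star (f * single γ n a) =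
      f * single γ 0 (a * star a) * star f := by
    rw [star_mul, ← mul_assoc, mul_assoc f, star_single, single_mul_single, ← pow_apply_add]
    simp
  have h2 : supp (f * single γ 0 (a * star a)) ⊆
    supp f ∪ supp (f * single γ 0 (a * star a)) := Finset.subset_union_right
  rw [mul_pow, norm_sq_mk, norm_sq_mk, h1, coeff_zero_mul_star h2,
    coeff_zero_mul_star (Finset.subset_union_left
      (s₂ := supp (f * single γ 0 (a * star a)))), ← Real.norm_of_nonneg (sq_nonneg ‖a‖),
    ← norm_smul, Finset.smul_sum]
  refine CStarAlgebra.norm_le_norm_of_nonneg_of_le (Finset.sum_nonneg fun m _ => ?_)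
    (Finset.sum_le_sum fun m _ => ?_)
  · rw [coeff_mul_single_zero, map_mul, map_star]
    exact star_right_conjugate_nonneg (mul_star_self_nonneg _) _
  · rw [coeff_mul_single_zero]
    refine (CStarAlgebra.star_right_conjugate_le_norm_smul (.map (.mul_star_self a) _)).trans_eq ?_
    rw [norm_zpow_apply, CStarRing.norm_self_mul_star, pow_two]

lemma norm_mk_mul_le (f g : ConvAlgebra γ) : ‖mk γ (g * f)‖ ≤ l1Norm f * ‖mk γ g‖ := by
  conv_lhs => rw [← sum_single f]
  rw [Finset.mul_sum, map_sum, l1Norm_eq, Finset.sum_mul]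
  exact norm_sum_le_of_le _ fun n _ => norm_mk_mul_single_le g n _

/-- Right multiplication by elements of `C_c(ℤ, A)` on the regular module. -/
def rightMul : ConvAlgebra γ →ₗ[ℂ] RegularModule γ →L[ℂ] RegularModule γ where
  toFun f := LinearMap.mkContinuous
    { toFun := fun g => mk γ ((mk γ).symm g * f)
      map_add' := fun g h => by simp only [map_add, add_mul]
      map_smul' := fun c g => by simp only [map_smul, smul_mul_assoc, RingHom.id_apply] }
    (l1Norm f) fun g => by simpa using norm_mk_mul_le f ((mk γ).symm g)
  map_add' f g := by ext h; simp [mul_add]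
  map_smul' c f := by ext h; exact congrArg (mk γ) (mul_smul_comm c ((mk γ).symm h) f)

lemma rightMul_mk (f g : ConvAlgebra γ) : rightMul f (mk γ g) = mk γ (g * f) := rfl

lemma norm_rightMul_mul_le (f g : ConvAlgebra γ) :
    ‖rightMul (f * g)‖ ≤ ‖rightMul f‖ * ‖rightMul g‖ := by
  have : rightMul (f * g) = (rightMul g).comp (rightMul f) := by
    ext h
    obtain ⟨h, rfl⟩ := (mk γ).surjective h
    simp only [ContinuousLinearMap.comp_apply, rightMul_mk, mul_assoc]
  rw [this, mul_comm]
  exact ContinuousLinearMap.opNorm_comp_le _ _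

/-- Cauchy–Schwarz applied to `E((gff⋆)g⋆)`, whose norm is the squared norm of `gf`. No adjoint
operators are needed. -/
lemma sq_norm_rightMul_le (f : ConvAlgebra γ) : ‖rightMul f‖ ^ 2 ≤ ‖rightMul (f * star f)‖ := by
  have h : ‖rightMul f‖ ≤ √‖rightMul (f * star f)‖ := by
    refine ContinuousLinearMap.opNorm_le_bound _ (Real.sqrt_nonneg _) fun g => ?_
    obtain ⟨g, rfl⟩ := (mk γ).surjective g
    refine le_of_pow_le_pow_left₀ two_ne_zero (by positivity) ?_
    rw [mul_pow, Real.sq_sqrt (norm_nonneg _), rightMul_mk, norm_sq_mk, star_mul, ← mul_assoc,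
      mul_assoc g]
    refine (norm_coeff_zero_mul_star_le _ _).trans ?_
    rw [← rightMul_mk, pow_two, ← mul_assoc]
    gcongr
    exact ContinuousLinearMap.le_opNorm _ _
  calc ‖rightMul f‖ ^ 2 ≤ √‖rightMul (f * star f)‖ ^ 2 := by gcongr
    _ = _ := Real.sq_sqrt (norm_nonneg _)

lemma norm_rightMul_star_le (f : ConvAlgebra γ) : ‖rightMul f‖ ≤ ‖rightMul (star f)‖ := by
  have := (sq_norm_rightMul_le f).trans (norm_rightMul_mul_le f (star f))
  by_contra! hlt
  nlinarith [norm_nonneg (rightMul f), norm_nonneg (rightMul (star f))]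

lemma norm_rightMul_star (f : ConvAlgebra γ) : ‖rightMul (star f)‖ = ‖rightMul f‖ :=
  le_antisymm (by simpa using norm_rightMul_star_le (star f)) (norm_rightMul_star_le f)

/-- Hence the universal norm dominates the operator norm of right multiplication, and with it every
Fourier coefficient. -/
lemma norm_rightMul_mem_cstarSeminorms :
    (normSeminorm ℂ _).comp (rightMul (γ := γ)) ∈ cstarSeminorms γ := by
  refine ⟨norm_rightMul_mul_le, fun f => ?_, fun f => ?_⟩
  · refine le_antisymm ((norm_rightMul_mul_le _ _).trans_eq ?_) ?_
    · rw [norm_rightMul_star, pow_two]; rfl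
    · have := sq_norm_rightMul_le (star f)
      rwa [star_star, norm_rightMul_star] at this
  · exact LinearMap.mkContinuous_norm_le _ (l1Norm_nonneg f) fun g => by
      simpa using norm_mk_mul_le f ((mk γ).symm g)

lemma norm_coeff_zero_le_norm_rightMul (f : ConvAlgebra γ) : ‖coeff 0 f‖ ≤ ‖rightMul f‖ := by
  rcases (norm_nonneg (coeff 0 f)).eq_or_lt with h | h
  · rw [← h]; exact norm_nonneg _
  refine le_of_mul_le_mul_right ?_ h
  -- The test vector `E(f)⋆` has norm `‖E(f)‖`, and its image has zeroth coefficient `E(f)⋆E(f)`.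
  have h1 := ContinuousLinearMap.le_opNorm (rightMul f) (mk γ (single γ 0 (star (coeff 0 f))))
  have h2 : ‖mk γ (single γ 0 (star (coeff 0 f)))‖ = ‖coeff 0 f‖ := by
    rw [← sq_eq_sq₀ (norm_nonneg _) (norm_nonneg _), norm_sq_mk, coeff_zero_single_mul_star,
      coeff_single_self, star_star, CStarRing.norm_star_mul_self, pow_two]
  rw [h2] at h1
  refine le_trans ?_ h1
  rw [rightMul_mk, ← CStarRing.norm_star_mul_self, ← coeff_single_zero_mul]
  exact norm_coeff_le _ _

end RegularModule

variable [PartialOrder A] [StarOrderedRing A]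

lemma norm_coeff_zero_le (f : ConvAlgebra γ) : ‖coeff 0 f‖ ≤ ‖f‖ :=
  (RegularModule.norm_coeff_zero_le_norm_rightMul f).trans
    (le_maxSeminorm RegularModule.norm_rightMul_mem_cstarSeminorms f)

lemma norm_coeff_le (f : ConvAlgebra γ) (n : ℤ) : ‖coeff n f‖ ≤ ‖f‖ := by
  refine le_of_pow_le_pow_left₀ two_ne_zero (norm_nonneg f)
    ((norm_coeff_sq_le f n).trans ((norm_coeff_zero_le _).trans ?_))
  exact (norm_mul_le _ _).trans_eq (by rw [norm_star, pow_two])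

omit [PartialOrder A] [StarOrderedRing A] in
lemma norm_single_le (n : ℤ) (a : A) : ‖single γ n a‖ ≤ ‖a‖ := by
  rw [norm_def, maxSeminorm_apply]
  refine ciSup_le fun p => (p.2.2.2 _).trans_eq ?_
  exact Finsupp.sum_single_index (M := A) norm_zero

end ConvAlgebra

end Coefficients

/-! ### Fourier coefficients on the crossed product and Parseval's identity -/

section FourierCoefficients

namespace CrossedProduct

open ConvAlgebra

variable {A : Type*} [NonUnitalCStarAlgebra A] {γ : A ≃⋆ₐ[ℂ] A}

/-- The `n`-th Fourier coefficient of an element of `A ⋊_γ ℤ`; for `n = 0` this is the canonical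
conditional expectation. -/
def coeffL (n : ℤ) : CrossedProduct γ →L[ℂ] A :=
  (coeff n).extendOfNorm (of γ).toLinearMap

lemma ι_apply (a : A) : ι γ a = of γ (single γ 0 a) := rfl

lemma norm_ι_le (a : A) : ‖ι γ a‖ ≤ ‖a‖ := NonUnitalStarAlgHom.norm_apply_le (ι γ) a

lemma continuous_ι : Continuous (ι γ) :=
  AddMonoidHomClass.continuous_of_bound (ι γ) 1 fun a => by simpa using norm_ι_le a

lemma continuous_zpow_apply (n : ℤ) : Continuous (γ ^ n : A ≃⋆ₐ[ℂ] A) :=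
  AddMonoidHomClass.continuous_of_bound (γ ^ n) 1 fun a => by
    simpa using NonUnitalStarAlgHom.norm_apply_le (γ ^ n) a

/-- On `C_c(ℤ, A)` this is checked on each `auⁿ`; contractivity of the `q r` extends it to the
completion. -/
lemma tendsto_ι_mul {l : Filter ℕ} {q : ℕ → A} (hq : ∀ r, ‖q r‖ ≤ 1)
    (hq' : ∀ a, Tendsto (fun r => q r * a) l (𝓝 a)) (x : CrossedProduct γ) :
    Tendsto (fun r => ι γ (q r) * x) l (𝓝 x) := by
  have hf : ∀ f : ConvAlgebra γ,
      Tendsto (fun r => ι γ (q r) * of γ f) l (𝓝 (of γ f)) := by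
    intro f
    induction f using induction_on with
    | zero => simpa using tendsto_const_nhds
    | add f g hf hg => simpa only [map_add, mul_add] using hf.add hg
    | one n a =>
      have h1 : Continuous fun a => of γ (single γ n a) :=
        AddMonoidHomClass.continuous_of_bound
          ((of γ).toLinearMap.toAddMonoidHom.comp (single γ n)) 1 fun a => by
            simpa using norm_single_le (γ := γ) n a
      have h2 := (h1.tendsto a).comp (hq' a)
      refine h2.congr fun r => ?_
      simp [ι_apply, ← of_mul, single_mul_single]
  rw [Metric.tendsto_nhds]
  intro ε hε
  obtain ⟨f, hfx⟩ := denseRange_of.exists_dist_lt x (show 0 < ε / 3 by positivity)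
  filter_upwards [Metric.tendsto_nhds.1 (hf f) (ε / 3) (by positivity)] with r hr
  rw [dist_eq_norm] at *
  have h1 : ι γ (q r) * x - x = ι γ (q r) * (x - of γ f) + (ι γ (q r) * of γ f - of γ f)
      - (x - of γ f) := by rw [mul_sub]; abel
  have h2 : ‖ι γ (q r) * (x - of γ f)‖ ≤ ‖x - of γ f‖ := (norm_mul_le _ _).trans
    (mul_le_of_le_one_left (norm_nonneg _) ((norm_ι_le _).trans (hq r)))
  rw [h1]
  refine (norm_sub_le _ _).trans_lt ?_
  have h3 := norm_add_le (ι γ (q r) * (x - of γ f)) (ι γ (q r) * of γ f - of γ f)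
  linarith

variable [PartialOrder A] [StarOrderedRing A]

lemma coeffL_of (n : ℤ) (f : ConvAlgebra γ) : coeffL n (of γ f) = coeff n f :=
  LinearMap.extendOfNorm_eq denseRange_of
    ⟨1, fun f => by simpa using norm_coeff_le f n⟩ f

lemma coeffL_ι (a : A) : coeffL 0 (ι γ a) = a := by
  rw [ι_apply, coeffL_of, coeff_single_self]

lemma norm_coeffL_le (n : ℤ) (x : CrossedProduct γ) : ‖coeffL n x‖ ≤ ‖x‖ :=
  denseRange_of.induction_on (p := fun x : CrossedProduct γ => ‖coeffL n x‖ ≤ ‖x‖) x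
    (isClosed_le (by fun_prop) (by fun_prop))
    fun f => by simpa only [coeffL_of, (of γ).norm_map] using norm_coeff_le f n

lemma coeffL_star (n : ℤ) (x : CrossedProduct γ) :
    coeffL n (star x) = (γ ^ n) (star (coeffL (-n) x)) :=
  denseRange_of.induction_on
    (p := fun x : CrossedProduct γ => coeffL n (star x) = (γ ^ n) (star (coeffL (-n) x))) x
    (isClosed_eq (by fun_prop) ((continuous_zpow_apply n).comp (by fun_prop)))
    fun f => by simp only [← of_star, coeffL_of, coeff_star]

lemma coeffL_zero_ι_mul (a : A) (x : CrossedProduct γ) :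
    coeffL 0 (ι γ a * x) = a * coeffL 0 x :=
  denseRange_of.induction_on
    (p := fun x : CrossedProduct γ => coeffL 0 (ι γ a * x) = a * coeffL 0 x) x
    (isClosed_eq (by fun_prop) (by fun_prop))
    fun f => by simp only [ι_apply, ← of_mul, coeffL_of, coeff_single_zero_mul]

lemma coeffL_zero_mul_ι (a : A) (x : CrossedProduct γ) :
    coeffL 0 (x * ι γ a) = coeffL 0 x * a :=
  denseRange_of.induction_on
    (p := fun x : CrossedProduct γ => coeffL 0 (x * ι γ a) = coeffL 0 x * a) x
    (isClosed_eq (by fun_prop) (by fun_prop))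
    fun f => by simp only [ι_apply, ← of_mul, coeffL_of, coeff_mul_single_zero, zpow_zero]; rfl

/-- The part of `E(xx⋆)` coming from the Fourier coefficients outside `s`. -/
def remainder (s : Finset ℤ) (x : CrossedProduct γ) : A :=
  coeffL 0 (x * star x) - ∑ n ∈ s, coeffL n x * star (coeffL n x)

lemma remainder_nonneg (s : Finset ℤ) (x : CrossedProduct γ) : 0 ≤ remainder s x :=
  denseRange_of.induction_on (p := fun x : CrossedProduct γ => 0 ≤ remainder s x) x
    (CStarAlgebra.isClosed_nonneg.preimage (by unfold remainder; fun_prop))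
    fun f => by
      simpa only [remainder, ← of_star, ← of_mul, coeffL_of, sub_nonneg]
        using sum_coeff_mul_star_le f s

lemma coeffL_zero_mul_star_self_nonneg (x : CrossedProduct γ) : 0 ≤ coeffL 0 (x * star x) := by
  simpa [remainder] using remainder_nonneg ∅ x

lemma coeffL_zero_nonneg {x : CrossedProduct γ} (hx : 0 ≤ x) : 0 ≤ coeffL 0 x := by
  have := coeffL_zero_mul_star_self_nonneg (CFC.sqrt x)
  rwa [star_sqrt, CFC.sqrt_mul_sqrt_self x hx] at this

lemma remainder_of {s : Finset ℤ} {f : ConvAlgebra γ} (hs : supp f ⊆ s) :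
    remainder s (of γ f) = 0 := by
  simp only [remainder, ← of_star, ← of_mul, coeffL_of, coeff_zero_mul_star hs, sub_self]

omit [PartialOrder A] [StarOrderedRing A] in
-- The remainder is a quadratic form in `x`, so it obeys the parallelogram law.
lemma remainder_add_add_remainder_sub (s : Finset ℤ) (x y : CrossedProduct γ) :
    remainder s (x + y) + remainder s (x - y) =
      (2 : ℕ) • remainder s x + (2 : ℕ) • remainder s y := by
  have h1 : (x + y) * star (x + y) + (x - y) * star (x - y) =
      (2 : ℕ) • (x * star x) + (2 : ℕ) • (y * star y) := by
    rw [star_add, star_sub]; noncomm_ring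
  have h2 : ∀ n, coeffL n (x + y) * star (coeffL n (x + y)) +
      coeffL n (x - y) * star (coeffL n (x - y)) =
      (2 : ℕ) • (coeffL n x * star (coeffL n x)) +
        (2 : ℕ) • (coeffL n y * star (coeffL n y)) := by
    intro n
    rw [map_add, map_sub, star_add, star_sub]; noncomm_ring
  have h3 := congrArg (coeffL (γ := γ) 0) h1
  have h4 := Finset.sum_congr (rfl : s = s) fun n _ => h2 n
  simp only [map_add, map_nsmul, Finset.sum_add_distrib, ← Finset.smul_sum] at h3 h4
  simp only [remainder, smul_sub, map_add, map_sub] at h3 h4 ⊢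
  calc _ = (coeffL 0 ((x + y) * star (x + y)) + coeffL 0 ((x - y) * star (x - y))) -
        (∑ n ∈ s, (coeffL n x + coeffL n y) * star (coeffL n x + coeffL n y) +
          ∑ n ∈ s, (coeffL n x - coeffL n y) * star (coeffL n x - coeffL n y)) := by abel
    _ = _ := by rw [h3, h4]; abel

/-- The remainder of `f` vanishes, so the parallelogram law for `f` and `x - f`, with one positive
term dropped, bounds the remainder of `x` by twice that of `x - f`. -/
lemma norm_remainder_le {s : Finset ℤ} {f : ConvAlgebra γ} (hs : supp f ⊆ s)
    (x : CrossedProduct γ) : ‖remainder s x‖ ≤ 2 * ‖x - of γ f‖ ^ 2 := by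
  have h1 := remainder_add_add_remainder_sub s (of γ f) (x - of γ f)
  rw [remainder_of hs, smul_zero, zero_add, add_sub_cancel] at h1
  have h2 : remainder s x ≤ (2 : ℝ) • coeffL 0 ((x - of γ f) * star (x - of γ f)) := by
    have h3 : remainder s x ≤ (2 : ℕ) • remainder s (x - of γ f) := by
      rw [← h1]; exact le_add_of_nonneg_right (remainder_nonneg _ _)
    refine h3.trans ?_
    rw [two_smul, two_smul]
    have h4 : remainder s (x - of γ f) ≤ coeffL 0 ((x - of γ f) * star (x - of γ f)) :=
      sub_le_self _ (Finset.sum_nonneg fun n _ => mul_star_self_nonneg _)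
    exact add_le_add h4 h4
  refine (CStarAlgebra.norm_le_norm_of_nonneg_of_le (remainder_nonneg s x) h2).trans ?_
  rw [norm_smul, Real.norm_ofNat]
  gcongr
  refine (norm_coeffL_le _ _).trans ?_
  rw [CStarRing.norm_self_mul_star, pow_two]

/-- Parseval's identity. -/
lemma hasSum_coeffL_mul_star (x : CrossedProduct γ) :
    HasSum (fun n => coeffL n x * star (coeffL n x)) (coeffL 0 (x * star x)) := by
  have : Tendsto (fun s : Finset ℤ => ∑ n ∈ s, coeffL n x * star (coeffL n x)) atTop
      (𝓝 (coeffL 0 (x * star x))) := by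
    rw [Metric.tendsto_atTop]
    intro ε hε
    obtain ⟨f, hf⟩ := denseRange_of.exists_dist_lt x (Real.sqrt_pos.2 (half_pos hε))
    refine ⟨supp f, fun s hs => ?_⟩
    rw [dist_comm, dist_eq_norm]
    refine (norm_remainder_le hs x).trans_lt ?_
    rw [dist_eq_norm] at hf
    have := Real.lt_sqrt (norm_nonneg _) |>.1 hf
    linarith
  exact this

end CrossedProduct

end FourierCoefficients

/-! ### Extending an invariant trace through the conditional expectation -/

section ExtendedTrace

namespace CrossedProduct

variable {A : Type*} [NonUnitalCStarAlgebra A] [PartialOrder A] [StarOrderedRing A]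
  {γ : A ≃⋆ₐ[ℂ] A}

/-- The composition of a map on `A₊` with the conditional expectation of `A ⋊_γ ℤ` onto `A`. -/
def extendTrace (σ : {a : A // 0 ≤ a} → ℝ≥0∞) : {x : CrossedProduct γ // 0 ≤ x} → ℝ≥0∞ :=
  fun x => σ ⟨coeffL 0 x.1, coeffL_zero_nonneg x.2⟩

variable {σ : {a : A // 0 ≤ a} → ℝ≥0∞}

lemma extendTrace_apply {x : CrossedProduct γ} (hx : 0 ≤ x) :
    extendTrace σ ⟨x, hx⟩ = coneExt σ (coeffL 0 x) :=
  (coneExt_of_nonneg σ (coeffL_zero_nonneg hx)).symm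

lemma restrict_extendTrace (σ : {a : A // 0 ≤ a} → ℝ≥0∞) :
    restrict γ (extendTrace σ) = σ := by
  funext a
  change σ ⟨coeffL 0 (ι γ a.1), _⟩ = σ a
  congr 1
  exact Subtype.ext (coeffL_ι a.1)

lemma coneExt_apply_of_isInvariantTrace (h : IsInvariantTrace γ σ) (n : ℤ) {a : A}
    (ha : 0 ≤ a) : coneExt σ ((γ ^ n) a) = coneExt σ a := by
  have h1 : ∀ b : A, 0 ≤ b → coneExt σ (γ b) = coneExt σ b := fun b hb => by
    rw [coneExt_of_nonneg σ hb, coneExt_of_nonneg σ (map_nonneg γ hb)]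
    exact h ⟨b, hb⟩
  induction n with
  | zero => simp
  | succ n ih =>
    rw [← ih, ← h1 _ (map_nonneg (γ ^ (n : ℤ)) ha), add_comm, ConvAlgebra.pow_apply_add, zpow_one]
  | pred n ih =>
    rw [← ih, ← h1 _ (map_nonneg (γ ^ (-(n : ℤ) - 1)) ha)]
    congr 1
    conv_rhs => rw [show -(n : ℤ) = 1 + (-(n : ℤ) - 1) by ring, ConvAlgebra.pow_apply_add, zpow_one]

lemma isTrace_extendTrace (hσ : IsDenselyDefinedLSCTrace σ) (h : IsInvariantTrace γ σ) :
    IsTrace (extendTrace (γ := γ) σ) where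
  map_add x y hx hy := by
    rw [extendTrace_apply, extendTrace_apply, extendTrace_apply, map_add,
      hσ.coneExt_add (coeffL_zero_nonneg hx) (coeffL_zero_nonneg hy)]
  map_smul c x hx := by
    rw [extendTrace_apply, extendTrace_apply, ← Complex.coe_smul, map_smul, Complex.coe_smul,
      hσ.coneExt_smul c.coe_nonneg (coeffL_zero_nonneg hx), ENNReal.ofReal_coe_nnreal]
  map_star_mul_self x := by
    -- As `(x⋆)ₙ = γⁿ(x₋ₙ⋆)`, invariance and the trace identity in `A` match the Parseval terms of
    -- `x⋆` and `x` after `n ↦ -n`.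
    have key : ∀ n : ℤ, coneExt σ (coeffL n (star x) * star (coeffL n (star x))) =
        coneExt σ (coeffL (-n) x * star (coeffL (-n) x)) := by
      intro n
      rw [coeffL_star, ← map_star (γ ^ n), ← map_mul (γ ^ n), star_star,
        coneExt_apply_of_isInvariantTrace h n (star_mul_self_nonneg _), hσ.coneExt_star_mul_self]
    have h1 := hasSum_coeffL_mul_star (star x)
    rw [star_star] at h1
    rw [extendTrace_apply, extendTrace_apply,
      hσ.coneExt_hasSum (fun n => mul_star_self_nonneg _) h1,
      hσ.coneExt_hasSum (fun n => mul_star_self_nonneg _) (hasSum_coeffL_mul_star x),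
      ← (Equiv.neg ℤ).tsum_eq fun n => coneExt σ (coeffL n x * star (coeffL n x))]
    exact tsum_congr key

lemma isDenselyDefinedLSCTrace_extendTrace (hσ : IsDenselyDefinedLSCTrace σ)
    (h : IsInvariantTrace γ σ) {q : ℕ → A} (hq : ∀ r, IsStarProjection (q r))
    (hq' : ∀ a, Tendsto (fun r => q r * a) atTop (𝓝 a)) :
    IsDenselyDefinedLSCTrace (extendTrace (γ := γ) σ) where
  toIsTrace := isTrace_extendTrace hσ h
  dense_domain := by
    refine (isTrace_extendTrace hσ h).dense_domain_of_projections (fun r => (hq r).map (ι γ))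
      (tendsto_ι_mul (fun r => (hq r).norm_le) hq') fun r => ?_
    rw [coneExt_of_nonneg _ (map_nonneg (ι γ) (hq r).nonneg), extendTrace_apply, coeffL_ι]
    exact hσ.coneExt_projection_lt_top (hq r)
  lowerSemicontinuous :=
    LowerSemicontinuous.comp hσ.lowerSemicontinuous
      (((coeffL (γ := γ) 0).continuous.comp continuous_subtype_val).subtype_mk _)

end CrossedProduct

end ExtendedTrace

/-! ### Restricting a trace to `A` -/

section Restriction

namespace CrossedProduct

variable {A : Type*} [NonUnitalCStarAlgebra A] [PartialOrder A] [StarOrderedRing A]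
  {γ : A ≃⋆ₐ[ℂ] A} {τ : {x : CrossedProduct γ // 0 ≤ x} → ℝ≥0∞}

lemma coneExt_restrict {a : A} (ha : 0 ≤ a) :
    coneExt (restrict γ τ) a = coneExt τ (ι γ a) := by
  rw [coneExt_of_nonneg _ ha, coneExt_of_nonneg τ (map_nonneg (ι γ) ha)]
  rfl

lemma isTrace_restrict (hτ : IsTrace τ) : IsTrace (restrict γ τ) where
  map_add a b ha hb := by
    simp only [restrict, ← coneExt_of_nonneg τ, map_add]
    exact hτ.coneExt_add (map_nonneg _ ha) (map_nonneg _ hb)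
  map_smul c a ha := by
    simp only [restrict, ← coneExt_of_nonneg τ]
    rw [← ENNReal.ofReal_coe_nnreal, ← hτ.coneExt_smul c.coe_nonneg (map_nonneg _ ha),
      ← Complex.coe_smul, map_smul, Complex.coe_smul]
  map_star_mul_self a := by
    simp only [restrict, ← coneExt_of_nonneg τ, map_mul, map_star]
    exact hτ.coneExt_star_mul_self _

lemma isInvariantTrace_restrict (hτ : IsTrace τ) : IsInvariantTrace γ (restrict γ τ) := by
  rintro ⟨a, ha⟩
  -- The element `v = γ(√a)u` satisfies `v⋆v = a` and `vv⋆ = γ(a)`.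
  have h := hτ.coneExt_star_mul_self (of γ (ConvAlgebra.single γ 1 (γ (CFC.sqrt a))))
  have hs : (γ ^ (-1 : ℤ)) (γ (CFC.sqrt a)) = CFC.sqrt a := by
    rw [zpow_neg_one]; exact γ.symm_apply_apply _
  rw [← of_star, ← of_mul, ← of_mul, ConvAlgebra.star_single, ConvAlgebra.single_mul_single,
    ConvAlgebra.single_mul_single, ← map_star, star_sqrt, hs, zpow_one,
    add_neg_cancel, neg_add_cancel, ← map_mul, CFC.sqrt_mul_sqrt_self a ha] at h
  simp only [restrict, ← coneExt_of_nonneg τ]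
  exact h.symm

lemma isDenselyDefinedLSCTrace_restrict (hτ : IsDenselyDefinedLSCTrace τ) {q : ℕ → A}
    (hq : ∀ r, IsStarProjection (q r))
    (hq' : ∀ a, Tendsto (fun r => q r * a) atTop (𝓝 a)) :
    IsDenselyDefinedLSCTrace (restrict γ τ) where
  toIsTrace := isTrace_restrict hτ.toIsTrace
  dense_domain := by
    refine (isTrace_restrict hτ.toIsTrace).dense_domain_of_projections hq hq' fun r => ?_
    rw [coneExt_restrict (hq r).nonneg]
    exact hτ.coneExt_projection_lt_top ((hq r).map (ι γ))
  lowerSemicontinuous :=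
    LowerSemicontinuous.comp hτ.lowerSemicontinuous
      ((continuous_ι.comp continuous_subtype_val).subtype_mk _)

end CrossedProduct

end Restriction

/-! ### Rokhlin towers and compression of off-diagonal terms -/

section Towers

variable {A : Type*} [NonUnitalCStarAlgebra A] [PartialOrder A] [StarOrderedRing A]
  {γ : A ≃⋆ₐ[ℂ] A}

omit [PartialOrder A] [StarOrderedRing A] in
-- The one-step shift estimate is iterated, wrapping around the tower. Pulling `γ` out of a product
-- moves the right factor `a` to `γ⁻¹(a)`, so the backward orbit of `a` must lie in `S`.
lemma norm_zpow_sub_shift_mul_le {f : ℕ → A} {p : ℕ} {S : Set A} {ε : ℝ} (hp : f p = f 0)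
    (hf : ∀ a ∈ S, ∀ j < p, ‖(γ (f j) - f (j + 1)) * a‖ ≤ ε) (m : ℕ) :
    ∀ a, (∀ i < m, (γ ^ (-(i : ℤ))) a ∈ S) → ∀ j < p,
      ‖((γ ^ (m : ℤ)) (f j) - f ((j + m) % p)) * a‖ ≤ m * ε := by
  induction m with
  | zero => intro a _ j hj; simp [Nat.mod_eq_of_lt hj]
  | succ m ih =>
    intro a ha j hj
    have hp0 : 0 < p := by omega
    have hr : (j + m) % p < p := Nat.mod_lt _ hp0
    have h1 : f ((j + (m + 1)) % p) = f ((j + m) % p + 1) := by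
      rw [← add_assoc, ← Nat.mod_add_mod (j + m) p 1]
      rcases Nat.lt_or_ge ((j + m) % p + 1) p with h | h
      · rw [Nat.mod_eq_of_lt h]
      · have h' : (j + m) % p + 1 = p := by omega
        rw [h', hp, Nat.mod_self]
    have h2 : (γ ^ ((m + 1 : ℕ) : ℤ)) (f j) = γ ((γ ^ (m : ℤ)) (f j)) := by
      rw [Nat.cast_succ, add_comm, ConvAlgebra.pow_apply_add, zpow_one]
    have h3 : γ ((γ ^ (-1 : ℤ)) a) = a := by
      rw [zpow_neg_one]; exact γ.apply_symm_apply a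
    have h4 : ((γ ^ ((m + 1 : ℕ) : ℤ)) (f j) - f ((j + (m + 1)) % p)) * a =
        γ (((γ ^ (m : ℤ)) (f j) - f ((j + m) % p)) * (γ ^ (-1 : ℤ)) a) +
          (γ (f ((j + m) % p)) - f ((j + m) % p + 1)) * a := by
      rw [h1, h2, map_mul, map_sub, h3]
      noncomm_ring
    have h5 := ih ((γ ^ (-1 : ℤ)) a) (fun i hi => by
      rw [← ConvAlgebra.pow_apply_add]
      have := ha (i + 1) (by omega)
      rwa [Nat.cast_succ, neg_add] at this) j hj
    have h6 := hf a (by simpa using ha 0 (by omega)) _ hr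
    rw [h4, Nat.cast_succ, add_mul, one_mul]
    refine (norm_add_le _ _).trans (add_le_add ?_ h6)
    rwa [StarAlgEquiv.norm_map]

/-- Replace `γᵐ(f j)` by the tower element `m` places on, at cost `mε`; commute it past `c`, and use
orthogonality, at cost `ε` each. The shift estimate has its test element on the right, whence the
adjoint of `c`. -/
lemma norm_mul_mul_zpow_le {f : ℕ → A} {p : ℕ} {S : Set A} {ε : ℝ} (hp : f p = f 0)
    (hf : ∀ a ∈ S, ∀ j < p, ‖(γ (f j) - f (j + 1)) * a‖ ≤ ε)
    (hpos : ∀ k < p, 0 ≤ f k ∧ ‖f k‖ ≤ 1)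
    (horth : ∀ a ∈ S, ∀ j < p, ∀ k < p, j ≠ k → ‖f k * f j * a‖ ≤ ε)
    (hcomm : ∀ a ∈ S, ∀ j < p, ‖f j * a - a * f j‖ ≤ ε)
    {m : ℕ} (hm : 0 < m) (hmp : m < p) {c : A} (hc : c ∈ S)
    (hc' : ∀ i < m, (γ ^ (-(i : ℤ))) (star c) ∈ S) {j : ℕ} (hj : j < p) :
    ‖f j * c * (γ ^ (m : ℤ)) (f j)‖ ≤ (m + 2) * ε := by
  have hr : (j + m) % p < p := Nat.mod_lt _ (by omega)
  have hne : (j + m) % p ≠ j := by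
    intro h
    rcases Nat.lt_or_ge (j + m) p with h1 | h1
    · rw [Nat.mod_eq_of_lt h1] at h; omega
    · rw [Nat.mod_eq_sub_mod h1, Nat.mod_eq_of_lt (by omega)] at h; omega
  set r := (j + m) % p
  have h1 := norm_zpow_sub_shift_mul_le hp hf m (star c) hc' j hj
  have h2 : ‖c * ((γ ^ (m : ℤ)) (f j) - f r)‖ ≤ m * ε := by
    rw [← norm_star, star_mul, star_sub, ← map_star,
      (IsSelfAdjoint.of_nonneg (hpos j hj).1).star_eq,
      (IsSelfAdjoint.of_nonneg (hpos r hr).1).star_eq]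
    exact h1
  have h3 := horth c hc r hr j hj hne
  have h4 := hcomm c hc r hr
  have h5 : f j * c * (γ ^ (m : ℤ)) (f j) =
      f j * (c * ((γ ^ (m : ℤ)) (f j) - f r) - (f r * c - c * f r)) + f j * f r * c := by
    noncomm_ring
  rw [h5]
  calc _ ≤ ‖f j‖ * (‖c * ((γ ^ (m : ℤ)) (f j) - f r)‖ + ‖f r * c - c * f r‖) +
        ‖f j * f r * c‖ := by
        refine (norm_add_le _ _).trans (add_le_add_left ((norm_mul_le _ _).trans ?_) _)
        gcongr
        exact norm_sub_le _ _
    _ ≤ 1 * (m * ε + ε) + ε := by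
        gcongr
        exact (hpos j hj).2
    _ = (m + 2) * ε := by ring

lemma RokhlinProperty.exists_almost_orthogonal {d : ℕ} (h : RokhlinProperty γ d) (N : ℕ) (q : A)
    (F : Finset A) {η : ℝ} (hη : 0 < η) :
    ∃ f : ℕ × ℕ → A,
      (∀ i ∈ Finset.range (d + 1) ×ˢ Finset.range (N + 1), 0 ≤ f i ∧ ‖f i‖ ≤ 1) ∧
      ‖(∑ i ∈ Finset.range (d + 1) ×ˢ Finset.range (N + 1), f i) * q - q‖ ≤ η ∧
      ∀ b ∈ F, ∀ n : ℤ, n ≠ 0 → n.natAbs ≤ N →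
        ∀ i ∈ Finset.range (d + 1) ×ˢ Finset.range (N + 1), ‖f i * b * (γ ^ n) (f i)‖ ≤ η := by
  classical
  -- The added elements serve the negative exponents; `F'` further contains the backward orbits
  -- needed for shifting. Towers of height `N + 1` do not return to their start within `N` steps.
  let G : Finset A := F ∪ (Finset.range (N + 1) ×ˢ F).image fun x => star ((γ ^ (x.1 : ℤ)) x.2)
  let F' : Finset A := {q} ∪ (G ∪
    (Finset.range N ×ˢ G).image fun x => (γ ^ (-(x.1 : ℤ))) (star x.2))
  have hε : 0 < η / (N + 2) := by positivity
  have hεη : η / (N + 2) ≤ η := div_le_self hη.le (by linarith [(Nat.cast_nonneg N : (0 : ℝ) ≤ N)])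
  obtain ⟨f, hpos, hp, horth, hsum, hcomm, hshift⟩ := h F' (N + 1) (by omega) _ hε
  have hG : ∀ c ∈ G, c ∈ F' := fun c hc =>
    Finset.mem_union_right _ (Finset.mem_union_left _ hc)
  have hG' : ∀ c ∈ G, ∀ i < N, (γ ^ (-(i : ℤ))) (star c) ∈ F' := fun c hc i hi =>
    Finset.mem_union_right _ (Finset.mem_union_right _ (Finset.mem_image.2
      ⟨(i, c), Finset.mem_product.2 ⟨Finset.mem_range.2 hi, hc⟩, rfl⟩))
  have key : ∀ c ∈ G, ∀ m : ℕ, 0 < m → m ≤ N → ∀ l ≤ d, ∀ j < N + 1,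
      ‖f l j * c * (γ ^ (m : ℤ)) (f l j)‖ ≤ η := by
    intro c hc m hm hmN l hl j hj
    refine (norm_mul_mul_zpow_le (S := F') (hp l hl) (fun a ha j hj => (hshift a ha l hl j hj).le)
      (hpos l hl) (fun a ha j hj k hk hjk => (horth a ha l hl j hj k hk hjk).le)
      (fun a ha j hj => (hcomm a ha l hl j hj).le) hm (by omega) (hG c hc)
      (fun i hi => hG' c hc i (by omega)) hj).trans ?_
    rw [mul_div_assoc', div_le_iff₀ (by positivity), mul_comm]
    gcongr
  have hmem : ∀ i ∈ Finset.range (d + 1) ×ˢ Finset.range (N + 1), i.1 ≤ d ∧ i.2 < N + 1 := by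
    intro i hi
    rw [Finset.mem_product, Finset.mem_range, Finset.mem_range] at hi
    exact ⟨by omega, hi.2⟩
  refine ⟨fun i => f i.1 i.2, fun i hi => hpos _ (hmem i hi).1 _ (hmem i hi).2, ?_, ?_⟩
  · rw [Finset.sum_product]
    exact (hsum q (by simp [F'])).le.trans hεη
  · intro b hb n hn hnN i hi
    obtain ⟨hl, hj⟩ := hmem i hi
    obtain ⟨m, rfl | rfl⟩ := Int.eq_nat_or_neg n
    · exact key b (Finset.mem_union_left _ hb) m (by omega) (by simpa using hnN) _ hl _ hj
    · have hmN : m ≤ N := by simpa using hnN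
      have hsa := (IsSelfAdjoint.of_nonneg (hpos _ hl _ hj).1).star_eq
      -- Applying `γᵐ` to `f b γ⁻ᵐ(f)` and taking adjoints gives `f γᵐ(b)⋆ γᵐ(f)`, with a positive
      -- exponent.
      have := key (star ((γ ^ (m : ℤ)) b)) (Finset.mem_union_right _ (Finset.mem_image.2
        ⟨(m, b), Finset.mem_product.2 ⟨Finset.mem_range.2 (by omega), hb⟩, rfl⟩)) m (by omega)
        hmN _ hl _ hj
      rw [← norm_star, star_mul, star_mul, star_star, ← map_star, hsa, ← mul_assoc] at this
      refine le_of_eq_of_le ?_ this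
      rw [← StarAlgEquiv.norm_map (γ ^ (m : ℤ)), map_mul, map_mul, ← ConvAlgebra.pow_apply_add]
      simp

lemma norm_sqrt_le_one {a : A} (ha : 0 ≤ a) (h : ‖a‖ ≤ 1) : ‖CFC.sqrt a‖ ≤ 1 := by
  have : ‖CFC.sqrt a‖ * ‖CFC.sqrt a‖ = ‖a‖ := by
    rw [← CStarRing.norm_star_mul_self, star_sqrt, CFC.sqrt_mul_sqrt_self a ha]
  nlinarith [norm_nonneg (CFC.sqrt a)]

/-- `norm_sqrt_mul_sq_le` is used once on each side, and each use costs a square. -/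
lemma norm_sqrt_mul_mul_sqrt_pow_le {a a' : A} (ha : 0 ≤ a) (ha' : 0 ≤ a') (h : ‖a‖ ≤ 1)
    (h' : ‖a'‖ ≤ 1) (b : A) :
    ‖CFC.sqrt a * b * CFC.sqrt a'‖ ^ 4 ≤ ‖b‖ ^ 3 * ‖a * b * a'‖ := by
  have h1 : ‖CFC.sqrt a * b * CFC.sqrt a'‖ ^ 2 ≤ ‖b‖ * ‖a * b * CFC.sqrt a'‖ := by
    have := norm_sqrt_mul_sq_le ha (b * CFC.sqrt a')
    rw [← mul_assoc, ← mul_assoc] at this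
    refine this.trans ?_
    gcongr
    exact (norm_mul_le _ _).trans
      (mul_le_of_le_one_right (norm_nonneg _) (norm_sqrt_le_one ha' h'))
  have h2 : ‖a * b * CFC.sqrt a'‖ ^ 2 ≤ ‖b‖ * ‖a * b * a'‖ := by
    have := norm_sqrt_mul_sq_le ha' (star (a * b))
    rw [norm_star, ← norm_star (CFC.sqrt a' * _), ← norm_star (a' * _)] at this
    simp only [star_mul, star_star, star_sqrt, (IsSelfAdjoint.of_nonneg ha').star_eq] at this
    refine this.trans ?_
    gcongr
    exact (norm_mul_le _ _).trans (mul_le_of_le_one_left (norm_nonneg _) h)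
  calc ‖CFC.sqrt a * b * CFC.sqrt a'‖ ^ 4 = (‖CFC.sqrt a * b * CFC.sqrt a'‖ ^ 2) ^ 2 := by ring
    _ ≤ (‖b‖ * ‖a * b * CFC.sqrt a'‖) ^ 2 := by gcongr
    _ = ‖b‖ ^ 2 * ‖a * b * CFC.sqrt a'‖ ^ 2 := by ring
    _ ≤ ‖b‖ ^ 2 * (‖b‖ * ‖a * b * a'‖) := by gcongr
    _ = _ := by ring

lemma zpow_sqrt (n : ℤ) {a : A} (ha : 0 ≤ a) :
    (γ ^ n) (CFC.sqrt a) = CFC.sqrt ((γ ^ n) a) := by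
  refine (CFC.sqrt_unique ?_ (map_nonneg (γ ^ n) (CFC.sqrt_nonneg a))).symm
  rw [← map_mul, CFC.sqrt_mul_sqrt_self a ha]

open ConvAlgebra CrossedProduct in
/-- Off-diagonal elements of `C_c(ℤ, A)` are almost killed by compression with the square roots of
suitable positive elements of a corner of `A` which almost sum up to its unit. -/
lemma RokhlinProperty.exists_almost_partition {d : ℕ} (h : RokhlinProperty γ d) {q : A}
    (hq : IsStarProjection q) {f : ConvAlgebra γ} (hf : coeff 0 f = 0) :
    ∃ s : Finset (ℕ × ℕ), ∀ η : ℝ, 0 < η → ∃ g : ℕ × ℕ → A,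
      (∀ i ∈ s, 0 ≤ g i ∧ g i * q = g i) ∧ ‖∑ i ∈ s, g i - q‖ ≤ η ∧
      ∀ i ∈ s, ‖ι γ (CFC.sqrt (g i)) * of γ f * ι γ (CFC.sqrt (g i))‖ ≤ η := by
  classical
  let N := (supp f).sup Int.natAbs
  -- The index set depends only on `f`, so `η` may later be chosen small relative to its
  -- cardinality.
  refine ⟨Finset.range (d + 1) ×ˢ Finset.range (N + 1), fun η hη => ?_⟩
  set C : ℝ := 1 + ∑ n ∈ supp f, ‖coeff n f‖ ^ 3 with hC
  have hC0 : 0 < C := by positivity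
  set c : ℝ := (supp f).card + 1
  have hc0 : 0 < c := by positivity
  obtain ⟨k, hk, hsum, hoff⟩ := h.exists_almost_orthogonal N q
    ((supp f).image fun n => q * coeff n f * (γ ^ n) q)
    -- The fourth power offsets the passage to square roots, `C` absorbs the cubed coefficient norms
    -- and `c` the number of terms of `f`.
    (η := min η ((η / c) ^ 4 / C)) (by positivity)
  have hqk : ∀ i, q * k i * q * q = q * k i * q := fun i => by
    rw [mul_assoc (q * k i), hq.isIdempotentElem.eq]
  have hg : ∀ i ∈ Finset.range (d + 1) ×ˢ Finset.range (N + 1), 0 ≤ q * k i * q := fun i hi =>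
    conjugate_nonneg_of_nonneg (hk i hi).1 hq.nonneg
  have hg1 : ∀ i ∈ Finset.range (d + 1) ×ˢ Finset.range (N + 1), ‖q * k i * q‖ ≤ 1 := by
    intro i hi
    calc ‖q * k i * q‖ ≤ ‖q‖ * ‖k i‖ * ‖q‖ := norm_mul₃_le
      _ ≤ 1 * 1 * 1 := by gcongr; exacts [hq.norm_le, (hk i hi).2, hq.norm_le]
      _ = 1 := by norm_num
  refine ⟨fun i => q * k i * q, fun i hi => ⟨hg i hi, hqk i⟩, ?_, fun i hi => ?_⟩
  · have : ∑ i ∈ Finset.range (d + 1) ×ˢ Finset.range (N + 1), q * k i * q - q =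
        q * ((∑ i ∈ Finset.range (d + 1) ×ˢ Finset.range (N + 1), k i) * q - q) := by
      rw [mul_sub, hq.isIdempotentElem.eq, ← mul_assoc, Finset.mul_sum, Finset.sum_mul]
    rw [this]
    exact (norm_mul_le _ _).trans ((mul_le_of_le_one_left (norm_nonneg _) hq.norm_le).trans
      (hsum.trans (min_le_left _ _)))
  · have hterm : ∀ n ∈ supp f, ‖CFC.sqrt (q * k i * q) * coeff n f *
        (γ ^ n) (CFC.sqrt (q * k i * q))‖ ≤ η / c := by
      intro n hn
      have hn0 : n ≠ 0 := by
        rintro rfl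
        exact (Finsupp.mem_support_iff.1 hn) hf
      have h1 := hoff _ (Finset.mem_image_of_mem _ hn) n hn0 (Finset.le_sup (f := Int.natAbs) hn)
        i hi
      have h2 : ‖q * k i * q * coeff n f * (γ ^ n) (q * k i * q)‖ ≤ (η / c) ^ 4 / C := by
        have : q * k i * q * coeff n f * (γ ^ n) (q * k i * q) =
            q * (k i * (q * coeff n f * (γ ^ n) q) * (γ ^ n) (k i)) * (γ ^ n) q := by
          simp only [map_mul, mul_assoc]
        rw [this]
        refine norm_mul₃_le.trans ?_
        rw [norm_zpow_apply]
        calc _ ≤ 1 * ((η / c) ^ 4 / C) * 1 := by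
              gcongr
              exacts [hq.norm_le, h1.trans (min_le_right _ _), hq.norm_le]
          _ = _ := by ring
      refine le_of_pow_le_pow_left₀ (n := 4) (by norm_num) (by positivity) ?_
      rw [zpow_sqrt n (hg i hi)]
      refine (norm_sqrt_mul_mul_sqrt_pow_le (hg i hi) (map_nonneg (γ ^ n) (hg i hi)) (hg1 i hi)
        (by rw [norm_zpow_apply]; exact hg1 i hi) _).trans ?_
      have h3 : ‖coeff n f‖ ^ 3 ≤ C := by
        have := Finset.single_le_sum (f := fun n => ‖coeff n f‖ ^ 3)
          (fun n _ => by positivity) hn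
        linarith
      calc _ ≤ C * ((η / c) ^ 4 / C) := by gcongr
        _ = _ := by field_simp
    have hexp : ι γ (CFC.sqrt (q * k i * q)) * of γ f * ι γ (CFC.sqrt (q * k i * q)) =
        ∑ n ∈ supp f, of γ (single γ n (CFC.sqrt (q * k i * q) * coeff n f *
          (γ ^ n) (CFC.sqrt (q * k i * q)))) := by
      conv_lhs => rw [← sum_single f]
      rw [map_sum, Finset.mul_sum, Finset.sum_mul]
      refine Finset.sum_congr rfl fun n _ => ?_
      simp [ι_apply, ← of_mul, single_mul_single]
    rw [hexp]
    refine (norm_sum_le_of_le (f := _) _ (n := fun _ => η / c) fun n hn => ?_).trans ?_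
    · rw [(of γ).norm_map]
      exact (norm_single_le _ _).trans (hterm n hn)
    · rw [Finset.sum_const, nsmul_eq_mul, mul_div_assoc', div_le_iff₀ hc0, mul_comm]
      gcongr
      simp [c]

end Towers

/-! ### Traces and almost partitions of the unit of a corner -/

section AlmostPartition

variable {A : Type*} [NonUnitalCStarAlgebra A] [PartialOrder A] [StarOrderedRing A]
  {τ : {a : A // 0 ≤ a} → ℝ≥0∞} {κ : Type*} {s : Finset κ} {q : A} {g : κ → A} {η : ℝ}

lemma sqrt_conj_corner {x a : A} (hq : IsStarProjection q) (hx : 0 ≤ x) (hx' : x * q = x) :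
    q * (CFC.sqrt x * a * CFC.sqrt x) * q = CFC.sqrt x * a * CFC.sqrt x := by
  have h1 := sqrt_mul_eq_self_of_mul_eq hx hx' hq.isSelfAdjoint
  have h2 := congrArg star h1
  rw [star_mul, star_sqrt, hq.isSelfAdjoint.star_eq] at h2
  rw [← mul_assoc, ← mul_assoc, h2, mul_assoc, h1]

lemma norm_sqrt_conj_sub_le {x a : A} (hq : IsStarProjection q) (hx : 0 ≤ x) (hx' : x * q = x)
    (ha : ‖a - q‖ ≤ η) : ‖CFC.sqrt x * a * CFC.sqrt x - x‖ ≤ ‖x‖ * η := by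
  have h1 := sqrt_mul_eq_self_of_mul_eq hx hx' hq.isSelfAdjoint
  have h2 : CFC.sqrt x * a * CFC.sqrt x - x = CFC.sqrt x * (a - q) * CFC.sqrt x := by
    rw [mul_sub, sub_mul, h1, CFC.sqrt_mul_sqrt_self x hx]
  have h3 : ‖CFC.sqrt x‖ * ‖CFC.sqrt x‖ = ‖x‖ := by
    rw [← CStarRing.norm_star_mul_self, star_sqrt, CFC.sqrt_mul_sqrt_self x hx]
  rw [h2]
  calc _ ≤ ‖CFC.sqrt x‖ * ‖a - q‖ * ‖CFC.sqrt x‖ := norm_mul₃_le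
    _ = ‖x‖ * ‖a - q‖ := by rw [← h3]; ring
    _ ≤ _ := by gcongr

omit [PartialOrder A] [StarOrderedRing A] in
lemma mul_projection_of_corner {x : A} (hq : IsStarProjection q) (hx : q * x * q = x) :
    x * q = x := by
  rw [← hx, mul_assoc (q * x), hq.isIdempotentElem.eq]

namespace IsTrace

lemma sum_coneExt_sqrt_conj (hτ : IsTrace τ) (hg : ∀ i ∈ s, 0 ≤ g i) {x : A} (hx : 0 ≤ x) :
    ∑ i ∈ s, coneExt τ (CFC.sqrt (g i) * x * CFC.sqrt (g i)) =
      coneExt τ (CFC.sqrt x * (∑ i ∈ s, g i) * CFC.sqrt x) := by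
  rw [Finset.mul_sum, Finset.sum_mul, hτ.coneExt_sum s fun i hi => sqrt_conj_nonneg x (hg i hi)]
  exact Finset.sum_congr rfl fun i hi => hτ.coneExt_sqrt_conj (hg i hi) hx

lemma coneExt_le_sum_sqrt_conj (hτ : IsTrace τ) (hq : IsStarProjection q)
    (hg : ∀ i ∈ s, 0 ≤ g i) (hs : ‖∑ i ∈ s, g i - q‖ ≤ η) {x : A} (hx : 0 ≤ x)
    (hx' : q * x * q = x) :
    coneExt τ x ≤ ∑ i ∈ s, coneExt τ (CFC.sqrt (g i) * x * CFC.sqrt (g i)) +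
      ENNReal.ofReal (‖x‖ * η) * coneExt τ q := by
  have h := mul_projection_of_corner hq hx'
  rw [hτ.sum_coneExt_sqrt_conj hg hx]
  refine hτ.coneExt_le_add_of_corner hq hx (sqrt_conj_nonneg x (Finset.sum_nonneg hg)) hx'
    (sqrt_conj_corner hq hx h) ?_
  rw [norm_sub_rev]
  exact norm_sqrt_conj_sub_le hq hx h hs

lemma sum_sqrt_conj_le_coneExt (hτ : IsTrace τ) (hq : IsStarProjection q)
    (hg : ∀ i ∈ s, 0 ≤ g i) (hs : ‖∑ i ∈ s, g i - q‖ ≤ η) {x : A} (hx : 0 ≤ x)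
    (hx' : q * x * q = x) :
    ∑ i ∈ s, coneExt τ (CFC.sqrt (g i) * x * CFC.sqrt (g i)) ≤ coneExt τ x +
      ENNReal.ofReal (‖x‖ * η) * coneExt τ q := by
  have h := mul_projection_of_corner hq hx'
  rw [hτ.sum_coneExt_sqrt_conj hg hx]
  exact hτ.coneExt_le_add_of_corner hq (sqrt_conj_nonneg x (Finset.sum_nonneg hg)) hx
    (sqrt_conj_corner hq hx h) hx' (norm_sqrt_conj_sub_le hq hx h hs)

/-- The approximation error is charged to `a`, not to `q`, so that it stays bounded when summed over
a partition. -/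
lemma coneExt_sqrt_conj_le (hτ : IsTrace τ) (hq : IsStarProjection q) {a x y f : A} {δ : ℝ}
    (ha : 0 ≤ a) (haq : a * q = a) (hx : 0 ≤ x) (hy : 0 ≤ y) (hf : IsSelfAdjoint f)
    (hδ : ‖x - y - f‖ ≤ δ) (hη : ‖CFC.sqrt a * f * CFC.sqrt a‖ ≤ η) :
    coneExt τ (CFC.sqrt a * x * CFC.sqrt a) ≤ coneExt τ (CFC.sqrt a * y * CFC.sqrt a) +
      (ENNReal.ofReal δ * coneExt τ a + ENNReal.ofReal η * coneExt τ q) := by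
  have hδ0 : 0 ≤ δ := (norm_nonneg _).trans hδ
  have hη0 : 0 ≤ η := (norm_nonneg _).trans hη
  have hxy : IsSelfAdjoint (x - y - f) := ((IsSelfAdjoint.of_nonneg hx).sub (.of_nonneg hy)).sub hf
  have h1 : CFC.sqrt a * (x - y - f) * CFC.sqrt a ≤ δ • a := sqrt_conj_le_smul_of_norm_le ha hxy hδ
  have h2 : CFC.sqrt a * f * CFC.sqrt a ≤ η • q :=
    le_smul_of_corner hq (hf.conjugate_self (.of_nonneg (CFC.sqrt_nonneg a)))
      (sqrt_conj_corner hq ha haq) hη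
  rw [← hτ.coneExt_smul hδ0 ha, ← hτ.coneExt_smul hη0 hq.nonneg,
    ← hτ.coneExt_add (smul_nonneg hδ0 ha) (smul_nonneg hη0 hq.nonneg),
    ← hτ.coneExt_add (sqrt_conj_nonneg a hy)
      (add_nonneg (smul_nonneg hδ0 ha) (smul_nonneg hη0 hq.nonneg))]
  refine hτ.coneExt_mono (sqrt_conj_nonneg a hx) ?_
  have h3 : CFC.sqrt a * x * CFC.sqrt a = CFC.sqrt a * y * CFC.sqrt a +
      (CFC.sqrt a * (x - y - f) * CFC.sqrt a + CFC.sqrt a * f * CFC.sqrt a) := by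
    noncomm_ring
  rw [h3]
  exact add_le_add_right (add_le_add h1 h2) _

/-- Comparison of the values of a trace at two positive elements of a corner whose difference is,
up to `δ`, almost killed by compression with the square roots of an almost partition of the unit
of the corner. -/
lemma coneExt_le_of_almost_partition (hτ : IsTrace τ) (hq : IsStarProjection q)
    (hg : ∀ i ∈ s, 0 ≤ g i ∧ g i * q = g i) (hs : ‖∑ i ∈ s, g i - q‖ ≤ η) {x y f : A} {δ : ℝ}
    (hx : 0 ≤ x) (hy : 0 ≤ y) (hx' : q * x * q = x) (hy' : q * y * q = y) (hf : IsSelfAdjoint f)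
    (hδ : ‖x - y - f‖ ≤ δ)
    (hη : ∀ i ∈ s, ‖CFC.sqrt (g i) * f * CFC.sqrt (g i)‖ ≤ η) :
    coneExt τ x ≤ coneExt τ y +
      ENNReal.ofReal (‖y‖ * η + (δ * (1 + η) + s.card * η) + ‖x‖ * η) * coneExt τ q := by
  have hδ0 : 0 ≤ δ := (norm_nonneg _).trans hδ
  have hη0 : 0 ≤ η := (norm_nonneg _).trans hs
  have hg0 : ∀ i ∈ s, 0 ≤ g i := fun i hi => (hg i hi).1
  have h1 := hτ.coneExt_le_sum_sqrt_conj hq hg0 hs hx hx'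
  have h2 := hτ.sum_sqrt_conj_le_coneExt hq hg0 hs hy hy'
  have h3 := Finset.sum_le_sum fun i hi =>
    hτ.coneExt_sqrt_conj_le hq (hg i hi).1 (hg i hi).2 hx hy hf hδ (hη i hi)
  rw [Finset.sum_add_distrib, Finset.sum_add_distrib, ← Finset.mul_sum, ← hτ.coneExt_sum s hg0,
    Finset.sum_const, nsmul_eq_mul] at h3
  have hsum : (∑ i ∈ s, g i) * q = ∑ i ∈ s, g i := by
    rw [Finset.sum_mul]; exact Finset.sum_congr rfl fun i hi => (hg i hi).2
  have hsum' : q * ∑ i ∈ s, g i = ∑ i ∈ s, g i := by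
    have := congrArg star hsum
    rwa [star_mul, hq.isSelfAdjoint.star_eq,
      (IsSelfAdjoint.of_nonneg (Finset.sum_nonneg hg0)).star_eq] at this
  -- Thus the `δ` errors total at most `δ(1 + η)τ(q)`, whatever the size of `s`; only `η` gets
  -- multiplied by `s.card`.
  have h4 : coneExt τ (∑ i ∈ s, g i) ≤ coneExt τ q + ENNReal.ofReal η * coneExt τ q :=
    hτ.coneExt_le_add_of_corner hq (Finset.sum_nonneg hg0) hq.nonneg (by rw [hsum', hsum])
      (by rw [hq.isIdempotentElem.eq, hq.isIdempotentElem.eq]) hs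
  rw [ENNReal.ofReal_add (by positivity) (by positivity),
    ENNReal.ofReal_add (by positivity) (by positivity),
    ENNReal.ofReal_add (p := δ * _) (by positivity) (by positivity), ENNReal.ofReal_mul hδ0,
    ENNReal.ofReal_mul (p := (s.card : ℝ)) (by positivity), ENNReal.ofReal_natCast,
    ENNReal.ofReal_add zero_le_one hη0, ENNReal.ofReal_one]
  calc coneExt τ x ≤ _ := h1
    _ ≤ _ := by grw [h3, h2, h4]
    _ = _ := by ring

end IsTrace

end AlmostPartition

/-! ### A trace is determined by its restriction -/

section Uniqueness

namespace CrossedProduct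

open ConvAlgebra

variable {A : Type*} [NonUnitalCStarAlgebra A] [PartialOrder A] [StarOrderedRing A]
  {γ : A ≃⋆ₐ[ℂ] A}

/-- Symmetrise an approximant within `δ/2` and remove its diagonal coefficient, which has norm at
most `δ/2` because `E` is contractive and kills `z`. -/
lemma exists_off_diagonal_approx {z : CrossedProduct γ} (hz : IsSelfAdjoint z)
    (hz0 : coeffL 0 z = 0) {δ : ℝ} (hδ : 0 < δ) :
    ∃ f : ConvAlgebra γ, IsSelfAdjoint f ∧ coeff 0 f = 0 ∧ ‖z - of γ f‖ ≤ δ := by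
  obtain ⟨f₀, hf₀⟩ := denseRange_of.exists_dist_lt z (half_pos hδ)
  rw [dist_eq_norm] at hf₀
  set f₁ : ConvAlgebra γ := (1 / 2 : ℂ) • (f₀ + star f₀) with hf₁
  have h1 : star f₁ = f₁ := by
    rw [hf₁, star_smul, star_add, star_star, add_comm]
    simp
  have h2 : ‖z - of γ f₁‖ ≤ δ / 2 := by
    have h3 : z - of γ f₁ = (1 / 2 : ℂ) • ((z - of γ f₀) + star (z - of γ f₀)) := by
      rw [star_sub, hz.star_eq, hf₁, map_smul, map_add, of_star, ← sub_eq_zero]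
      module
    rw [h3, norm_smul, show ‖(1 / 2 : ℂ)‖ = 1 / 2 by norm_num]
    have h4 := norm_add_le (z - of γ f₀) (star (z - of γ f₀))
    rw [norm_star] at h4
    linarith
  have h5 : ‖coeff 0 f₁‖ ≤ δ / 2 := by
    have h6 := norm_coeffL_le 0 (z - of γ f₁)
    rw [map_sub, hz0, coeffL_of, zero_sub, norm_neg] at h6
    exact h6.trans h2
  have h7 : star (coeff 0 f₁) = coeff 0 f₁ := by
    have := coeff_star 0 f₁
    rw [h1] at this
    simpa using this.symm
  refine ⟨f₁ - single γ 0 (coeff 0 f₁), ?_, ?_, ?_⟩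
  · rw [IsSelfAdjoint, star_sub, h1, star_single, h7]
    simp
  · rw [map_sub, coeff_single_self, sub_self]
  · have h8 : z - of γ (f₁ - single γ 0 (coeff 0 f₁)) =
        (z - of γ f₁) + of γ (single γ 0 (coeff 0 f₁)) := by rw [map_sub]; abel
    rw [h8]
    refine (norm_add_le _ _).trans ?_
    have h9 := norm_single_le (γ := γ) 0 (coeff 0 f₁)
    rw [(of γ).norm_map]
    linarith

lemma ι_sqrt {a : A} (ha : 0 ≤ a) : ι γ (CFC.sqrt a) = CFC.sqrt (ι γ a) := by
  refine (CFC.sqrt_unique ?_ (map_nonneg (ι γ) (CFC.sqrt_nonneg a))).symm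
  rw [← map_mul, CFC.sqrt_mul_sqrt_self a ha]

variable {τ : {x : CrossedProduct γ // 0 ≤ x} → ℝ≥0∞}

/-- Under the Rokhlin condition, the value of a trace at a positive element of a corner on which it
is finite depends only on the conditional expectation of that element. -/
lemma coneExt_le_of_coeffL_zero_eq {d : ℕ} (h : RokhlinProperty γ d) (hτ : IsTrace τ) {q : A}
    (hq : IsStarProjection q) (hfin : coneExt τ (ι γ q) ≠ ∞) {x y : CrossedProduct γ} (hx : 0 ≤ x)
    (hy : 0 ≤ y) (hx' : ι γ q * x * ι γ q = x) (hy' : ι γ q * y * ι γ q = y)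
    (hxy : coeffL 0 x = coeffL 0 y) : coneExt τ x ≤ coneExt τ y := by
  refine ENNReal.le_of_forall_pos_le_add fun ε hε _ => ?_
  set T := (coneExt τ (ι γ q)).toReal with hT
  have hT0 : 0 ≤ T := ENNReal.toReal_nonneg
  have hε' : (0 : ℝ) < ε := hε
  -- The total error will be at most `3δT`; `T + 1` avoids dividing by zero.
  set δ : ℝ := ε / (3 * (T + 1)) with hδ
  have hδ0 : 0 < δ := by positivity
  obtain ⟨f, hfs, hf0, hfδ⟩ := exists_off_diagonal_approx (z := x - y)
    ((IsSelfAdjoint.of_nonneg hx).sub (.of_nonneg hy)) (by rw [map_sub, hxy, sub_self]) hδ0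
  obtain ⟨s, hs⟩ := h.exists_almost_partition hq hf0
  set C : ℝ := 1 + ‖x‖ + ‖y‖ + s.card with hC
  have hC0 : 0 < C := by positivity
  -- The order of choices is `δ`, `f`, `s`, then `η`: this makes `(‖x‖ + ‖y‖ + s.card)η ≤ δ` and
  -- `δ(1 + η) ≤ 2δ`.
  obtain ⟨g, hg, hsum, hoff⟩ := hs (min 1 (δ / C)) (by positivity)
  set η := min 1 (δ / C) with hη
  have hη0 : 0 ≤ η := by positivity
  have hη1 : η ≤ 1 := min_le_left _ _
  have hηC : C * η ≤ δ := by
    have := (le_div_iff₀ hC0).1 (min_le_right 1 (δ / C)); linarith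
  have key := hτ.coneExt_le_of_almost_partition (s := s) (g := fun i => ι γ (g i)) (η := η) (δ := δ)
    (hq.map (ι γ))
    (fun i hi => ⟨map_nonneg (ι γ) (hg i hi).1, by rw [← map_mul, (hg i hi).2]⟩)
    (by rw [← map_sum, ← map_sub]; exact (norm_ι_le _).trans hsum) hx hy hx' hy'
    (f := of γ f) (by rw [IsSelfAdjoint, ← of_star, hfs.star_eq]) hfδ
    (fun i hi => by rw [← ι_sqrt (hg i hi).1]; exact hoff i hi)
  refine key.trans (add_le_add_right ?_ _)
  rw [← ENNReal.ofReal_toReal hfin, ← hT, ← ENNReal.ofReal_mul (by positivity),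
    ← ENNReal.ofReal_coe_nnreal]
  refine ENNReal.ofReal_le_ofReal ?_
  have h1 : ‖y‖ * η + (δ * (1 + η) + s.card * η) + ‖x‖ * η ≤ 3 * δ := by
    have h2 : δ * η ≤ δ := mul_le_of_le_one_right hδ0.le hη1
    have h3 : (1 + ‖x‖ + ‖y‖ + s.card) * η ≤ δ := hηC
    nlinarith
  calc _ ≤ 3 * δ * T := by gcongr
    _ ≤ 3 * δ * (T + 1) := by gcongr; linarith
    _ = ε := by rw [hδ]; field_simp

/-- Both `qxq` and `qE(x)q` lie in the corner of `q` and have the same expectation, because `E` is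
an `A`-bimodule map. -/
lemma coneExt_corner_eq {d : ℕ} (h : RokhlinProperty γ d) (hτ : IsDenselyDefinedLSCTrace τ) {q : A}
    (hq : IsStarProjection q) {x : CrossedProduct γ} (hx : 0 ≤ x) :
    coneExt τ (ι γ q * x * ι γ q) = coneExt (restrict γ τ) (q * coeffL 0 x * q) := by
  have hE := coeffL_zero_nonneg hx
  have hQ := hq.map (ι γ)
  have h0 : 0 ≤ q * coeffL 0 x * q := conjugate_nonneg_of_nonneg hE hq.nonneg
  have h1 : 0 ≤ ι γ q * x * ι γ q := conjugate_nonneg_of_nonneg hx hQ.nonneg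
  have h2 : ι γ q * (ι γ q * x * ι γ q) * ι γ q = ι γ q * x * ι γ q := by
    rw [← mul_assoc, ← mul_assoc, hQ.isIdempotentElem.eq, mul_assoc (ι γ q * x),
      hQ.isIdempotentElem.eq]
  have h3 : ι γ q * ι γ (q * coeffL 0 x * q) * ι γ q = ι γ (q * coeffL 0 x * q) := by
    rw [← map_mul, ← map_mul, ← mul_assoc, ← mul_assoc, hq.isIdempotentElem.eq,
      mul_assoc (q * coeffL 0 x), hq.isIdempotentElem.eq]
  have h4 : coeffL 0 (ι γ q * x * ι γ q) = coeffL 0 (ι γ (q * coeffL 0 x * q)) := by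
    rw [coeffL_ι, coeffL_zero_mul_ι, coeffL_zero_ι_mul]
  have hfin := (hτ.coneExt_projection_lt_top hQ).ne
  have h5 := map_nonneg (ι γ) h0
  rw [coneExt_restrict h0]
  exact le_antisymm
    (coneExt_le_of_coeffL_zero_eq h hτ.toIsTrace hq hfin h1 h5 h2 h3 h4)
    (coneExt_le_of_coeffL_zero_eq h hτ.toIsTrace hq hfin h5 h1 h3 h2 h4.symm)

lemma eq_of_restrict_eq {d : ℕ} (h : RokhlinProperty γ d) {q : ℕ → A}
    (hq : ∀ r, IsStarProjection (q r)) (hq' : ∀ a, Tendsto (fun r => q r * a) atTop (𝓝 a))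
    {τ₁ τ₂ : {x : CrossedProduct γ // 0 ≤ x} → ℝ≥0∞} (h₁ : IsDenselyDefinedLSCTrace τ₁)
    (h₂ : IsDenselyDefinedLSCTrace τ₂) (h₁₂ : restrict γ τ₁ = restrict γ τ₂) : τ₁ = τ₂ := by
  funext ⟨x, hx⟩
  have hQ : ∀ r, IsStarProjection (ι γ (q r)) := fun r => (hq r).map (ι γ)
  have hQ' := tendsto_ι_mul (γ := γ) (fun r => (hq r).norm_le) hq'
  have key : ∀ r, coneExt τ₁ (ι γ (q r) * x * ι γ (q r)) =
      coneExt τ₂ (ι γ (q r) * x * ι γ (q r)) := fun r => by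
    rw [coneExt_corner_eq h h₁ (hq r) hx, coneExt_corner_eq h h₂ (hq r) hx, h₁₂]
  rw [← coneExt_of_nonneg τ₁, ← coneExt_of_nonneg τ₂]
  exact le_antisymm (h₁.coneExt_le_of_corners h₂.toIsTrace hQ hQ' hx fun r => (key r).le)
    (h₂.coneExt_le_of_corners h₁.toIsTrace hQ hQ' hx fun r => (key r).ge)

end CrossedProduct

end Uniqueness

end

theorem lemma1p9 {A : Type*} [NonUnitalCStarAlgebra A] [PartialOrder A] [StarOrderedRing A]
    [TopologicalSpace.SeparableSpace A]
    (q : ℕ → A) (hq : ∀ r, IsStarProjection (q r))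
    (hq_unit : (Filter.map q Filter.atTop).IsApproximateUnit)
    (γ : A ≃⋆ₐ[ℂ] A) (hγ : HasFiniteRokhlinDimension γ) :
    Set.BijOn (CrossedProduct.restrict γ)
      {τ | IsDenselyDefinedLSCTrace τ}
      {τ | IsDenselyDefinedLSCTrace τ ∧ IsInvariantTrace γ τ} := by
  obtain ⟨d, hd, -⟩ := hγ
  have hq' : ∀ a, Tendsto (fun r => q r * a) atTop (𝓝 a) := fun a =>
    tendsto_map'_iff.1 (hq_unit.tendsto_mul_right a)
  refine ⟨fun τ hτ => ⟨CrossedProduct.isDenselyDefinedLSCTrace_restrict hτ hq hq',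
    CrossedProduct.isInvariantTrace_restrict hτ.toIsTrace⟩,
    fun τ₁ h₁ τ₂ h₂ h => CrossedProduct.eq_of_restrict_eq hd hq hq' h₁ h₂ h,
    fun σ hσ => ⟨CrossedProduct.extendTrace σ,
      CrossedProduct.isDenselyDefinedLSCTrace_extendTrace hσ.1 hσ.2 hq hq',
      CrossedProduct.restrict_extendTrace σ⟩⟩
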